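/- Let $k$ be a finite field, $\Upsilon$ a group and $H$ a finite normal subgroup of $\Upsilon$. Definitions. A group $G$ with profinite completion $\hat G$ is called good if for every finite discrete continuous $\hat G$-module $M$ and every $n\ge 0$ the canonical map $\mathrm{H}^n(\hat G,M)\to \mathrm{H}^n(G,M)$, from continuous cohomology to ordinary group cohomology, is bijective. For a ring $A$, $\mathrm{Ho}(A)$ and $D(A)$ denote the homotopy category of (unbounded) complexes of left $A$-modules and the derived category, and $\mathrm{Comp}^b(A\text{-proj})$ denotes the bounded complexes of finitely generated projective $A$-modules; an object of $D(A)$ is perfect if it is isomorphic in $D(A)$ to an object of $\mathrm{Comp}^b(A\text{-proj})$. The relative homotopy category $\mathrm{Ho}(k\Upsilon,kH)$ is the Verdier quotient of the triangulated category $\mathrm{Ho}(k\Upsilon)$ by the thick subcategory of complexes $C$ with $\mathrm{Res}_H C= 0$ in $\mathrm{Ho}(kH)$; since such complexes are acyclic, there is a quotient functor $\mathrm{Ho}(k\Upsilon,kH)\to D(k\Upsilon)$, the identity on complexes. Proposition. Suppose that $\Upsilon/H$ is good. Then the quotient functor $\mathrm{Ho}(k\Upsilon,kH)\to D(k\Upsilon)$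 restricts to an equivalence from the full subcategory of $\mathrm{Ho}(k\Upsilon,kH)$ of complexes $C$ such that $\mathrm{Res}_H C\in \mathrm{Comp}^b(kH\text{-proj})$ to the full subcategory of $D(k\Upsilon)$ of complexes $D$ such that $\mathrm{Res}_H D$ is perfect. This holds both when the condition on $C$ is read literally ($\mathrm{Res}_H C$ is itself a bounded complex of finitely generated projective $kH$-modules) and when it is read up to homotopy ($\mathrm{Res}_H C$ is isomorphic in $\mathrm{Ho}(kH)$ to such a complex). -/

import Mathlib

open CategoryTheory CategoryTheory.Limits

universe u w₁ w₂

/-! ### Continuous group cohomology and good groups -/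

namespace GoodGroup

/-- The differential `Fun(Gⁿ, M) → Fun(Gⁿ⁺¹, M)` on inhomogeneous cochains of the `G`-module
`(M, ρ)`:
`(d f)(g₀,…,gₙ) = g₀ f(g₁,…,gₙ) + ∑_{j=0}^{n} (-1)^{j+1} f(…, gⱼ gⱼ₊₁, …)`,
where the last summand (`j = n`) is `(-1)^{n+1} f(g₀,…,gₙ₋₁)`. -/
def differential {G M : Type u} [Group G] [AddCommGroup M] (ρ : G →* AddMonoid.End M) (n : ℕ) :
    ((Fin n → G) → M) →+ ((Fin (n + 1) → G) → M) where
  toFun f g := ρ (g 0) (f fun i => g i.succ) +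
    ∑ j : Fin (n + 1), (-1 : ℤ) ^ ((j : ℕ) + 1) • f (Fin.contractNth j (· * ·) g)
  map_zero' := by ext; simp
  map_add' f f' := by
    ext
    simp [Finset.sum_add_distrib, add_add_add_comm]

/-- Continuous cochains `Gⁿ → M`, where `M` is discrete. -/
def cochains (G M : Type u) [TopologicalSpace G] [AddCommGroup M] (n : ℕ) :
    AddSubgroup ((Fin n → G) → M) where
  carrier := {f | IsLocallyConstant f}
  zero_mem' := IsLocallyConstant.const 0
  add_mem' h h' := h.add h'
  neg_mem' h := h.neg

/-- Continuous `n`-cocycles. -/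
def cocycles {G M : Type u} [Group G] [TopologicalSpace G] [AddCommGroup M]
    (ρ : G →* AddMonoid.End M) (n : ℕ) : AddSubgroup ((Fin n → G) → M) :=
  cochains G M n ⊓ (differential ρ n).ker

/-- Continuous `n`-coboundaries. -/
def coboundaries {G M : Type u} [Group G] [TopologicalSpace G] [AddCommGroup M]
    (ρ : G →* AddMonoid.End M) : (n : ℕ) → AddSubgroup ((Fin n → G) → M)
  | 0 => ⊥
  | n + 1 => (cochains G M n).map (differential ρ n)

/-- The continuous cohomology group `Hⁿ(G, M)` of the topological group `G` with coefficients in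
the discrete `G`-module `(M, ρ)`; it is the ordinary group cohomology if `G` is discrete. -/
abbrev Cohomology {G M : Type u} [Group G] [TopologicalSpace G] [AddCommGroup M]
    (ρ : G →* AddMonoid.End M) (n : ℕ) : Type u :=
  cocycles ρ n ⧸ (coboundaries ρ n).addSubgroupOf (cocycles ρ n)

/-- Restriction of cochains along a group homomorphism. -/
def cochainsRes {G G' : Type u} (M : Type u) [Group G] [Group G'] [AddCommGroup M]
    (φ : G' →* G) (n : ℕ) : ((Fin n → G) → M) →+ ((Fin n → G') → M) where
  toFun f g := f (φ ∘ g)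
  map_zero' := rfl
  map_add' _ _ := rfl

lemma differential_cochainsRes {G G' M : Type u} [Group G] [Group G'] [AddCommGroup M]
    (ρ : G →* AddMonoid.End M) (φ : G' →* G) (n : ℕ) (f : (Fin n → G) → M) :
    differential (ρ.comp φ) n (cochainsRes M φ n f) =
      cochainsRes M φ (n + 1) (differential ρ n f) := by
  ext g
  simp only [differential, cochainsRes, AddMonoidHom.coe_mk, ZeroHom.coe_mk, MonoidHom.comp_apply,
    Function.comp_apply]
  congr 1
  refine Finset.sum_congr rfl fun j _ => ?_
  congr 2
  exact Fin.comp_contractNth _ _ (map_mul φ) j g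

section

variable {G G' M : Type u} [Group G] [TopologicalSpace G] [Group G'] [TopologicalSpace G']
  [AddCommGroup M]

lemma cochainsRes_mem_cochains (φ : G' →* G) (hφ : Continuous φ) (n : ℕ) {f : (Fin n → G) → M}
    (hf : f ∈ cochains G M n) : cochainsRes M φ n f ∈ cochains G' M n := by
  have h : Continuous fun g : Fin n → G' => (φ ∘ g : Fin n → G) :=
    continuous_pi fun i => hφ.comp (continuous_apply i)
  have hf' : IsLocallyConstant f := hf
  exact hf'.comp_continuous h

lemma cochainsRes_mem_cocycles (ρ : G →* AddMonoid.End M) (φ : G' →* G) (hφ : Continuous φ)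
    (n : ℕ) {f : (Fin n → G) → M} (hf : f ∈ cocycles ρ n) :
    cochainsRes M φ n f ∈ cocycles (ρ.comp φ) n := by
  refine ⟨cochainsRes_mem_cochains φ hφ n hf.1, ?_⟩
  have h : differential ρ n f = 0 := hf.2
  change differential (ρ.comp φ) n (cochainsRes M φ n f) = 0
  rw [differential_cochainsRes, h, map_zero]

lemma cochainsRes_mem_coboundaries (ρ : G →* AddMonoid.End M) (φ : G' →* G) (hφ : Continuous φ)
    (n : ℕ) {f : (Fin n → G) → M} (hf : f ∈ coboundaries ρ n) :
    cochainsRes M φ n f ∈ coboundaries (ρ.comp φ) n := by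
  cases n with
  | zero =>
    have h : f = 0 := hf
    rw [h, map_zero]
    exact zero_mem _
  | succ n =>
    obtain ⟨c, hc, rfl⟩ := hf
    exact ⟨cochainsRes M φ n c, cochainsRes_mem_cochains φ hφ n hc,
      differential_cochainsRes ρ φ n c⟩

/-- The canonical map `Hⁿ(G, M) → Hⁿ(G', M)` induced by a continuous homomorphism `G' → G`. -/
def cohomologyRes (ρ : G →* AddMonoid.End M) (φ : G' →* G) (hφ : Continuous φ) (n : ℕ) :
    Cohomology ρ n →+ Cohomology (ρ.comp φ) n :=
  QuotientAddGroup.map _ _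
    (((cochainsRes M φ n).comp (cocycles ρ n).subtype).codRestrict (cocycles (ρ.comp φ) n)
      fun f => cochainsRes_mem_cocycles ρ φ hφ n f.2)
    fun _ hf => cochainsRes_mem_coboundaries ρ φ hφ n hf

end

/-- The profinite completion of `G`. -/
abbrev Completion (G : Type u) [Group G] : ProfiniteGrp.{u} :=
  ProfiniteGrp.ProfiniteCompletion.completion (GrpCat.of G)

/-- The canonical homomorphism from `G` to its profinite completion. -/
def toCompletion (G : Type u) [Group G] : G →* Completion G :=
  (ProfiniteGrp.ProfiniteCompletion.eta (GrpCat.of G)).hom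

/-- A group `G` is *good* if for every finite (continuous, discrete) module `M` over its profinite
completion `Ĝ` and every `n`, the canonical map `Hⁿ(Ĝ, M) → Hⁿ(G, M)` from continuous cohomology
to ordinary group cohomology is bijective. -/
def IsGood (G : Type u) [Group G] : Prop :=
  letI : TopologicalSpace G := ⊥
  ∀ (M : Type u) [AddCommGroup M] [Finite M] (ρ : Completion G →* AddMonoid.End M),
    (∀ m : M, IsLocallyConstant fun g : Completion G => ρ g m) →
      ∀ n : ℕ, Function.Bijective (cohomologyRes ρ (toCompletion G) continuous_bot n)

end GoodGroup

/-! ### Relative homotopy categories -/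

namespace RelHo

section

variable {A B : Type u} [Ring A] [Ring B] (φ : A →+* B)

instance : PreservesFiniteLimits (ModuleCat.restrictScalars.{u} φ) :=
  ⟨fun _ _ _ => ⟨inferInstance⟩⟩

instance : PreservesFiniteColimits (ModuleCat.restrictScalars.{u} φ) :=
  ⟨fun _ _ _ => ⟨inferInstance⟩⟩

/-- The restriction functor `Ho(B) ⥤ Ho(A)` along `φ : A → B`. -/
noncomputable abbrev resHo :
    HomotopyCategory (ModuleCat.{u} B) (ComplexShape.up ℤ) ⥤
      HomotopyCategory (ModuleCat.{u} A) (ComplexShape.up ℤ) :=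
  (ModuleCat.restrictScalars.{u} φ).mapHomotopyCategory (ComplexShape.up ℤ)

/-- The thick subcategory of `Ho(B)` of the complexes whose restriction to `A` is zero
in `Ho(A)`. -/
def resKernel : ObjectProperty (HomotopyCategory (ModuleCat.{u} B) (ComplexShape.up ℤ)) :=
  ObjectProperty.inverseImage IsZero (resHo φ)

instance : (resKernel φ).IsTriangulated :=
  have : ObjectProperty.IsTriangulated (IsZero : ObjectProperty
      (HomotopyCategory (ModuleCat.{u} A) (ComplexShape.up ℤ))) :=
    { toIsTriangulatedClosed₂ := .mk' fun T hT h₁ h₃ =>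
        (Pretriangulated.Triangle.isZero₂_iff T hT).2 ⟨h₁.eq_of_src _ _, h₃.eq_of_tgt _ _⟩
      isStableUnderShiftBy := fun n => ⟨fun _ hX => Functor.map_isZero (shiftFunctor _ n) hX⟩ }
  inferInstanceAs (ObjectProperty.inverseImage IsZero (resHo φ)).IsTriangulated

/-- The relative homotopy category `Ho(B, A)`: the Verdier quotient of `Ho(B)` by the complexes
that are zero in `Ho(A)`, that is, the localization at the morphisms whose cone is such. -/
abbrev HoRel := (resKernel φ).trW.Localization

/-- The quotient functor `Ho(B) ⥤ Ho(B, A)`. -/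
abbrev toHoRel : HomotopyCategory (ModuleCat.{u} B) (ComplexShape.up ℤ) ⥤ HoRel φ :=
  (resKernel φ).trW.Q

/-- The functor `Ho(B, A) ⥤ Ho(A)` induced by restriction. -/
noncomputable def hoRelRes :
    HoRel φ ⥤ HomotopyCategory (ModuleCat.{u} A) (ComplexShape.up ℤ) :=
  Localization.Construction.lift (resHo φ) (by
    rintro X Y f ⟨Z, g, h, hT, hZ⟩
    exact (Pretriangulated.Triangle.isZero₃_iff_isIso₁ _
      ((resHo φ).map_distinguished _ hT)).1 hZ)

lemma resKernel_le_acyclic :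
    resKernel φ ≤ HomotopyCategory.subcategoryAcyclic (ModuleCat.{u} B) := by
  intro X hX
  obtain ⟨K, rfl⟩ := HomotopyCategory.quotient_obj_surjective X
  rw [HomotopyCategory.quotient_obj_mem_subcategoryAcyclic_iff_exactAt]
  have h : HomotopyCategory.subcategoryAcyclic (ModuleCat.{u} A)
      ((HomotopyCategory.quotient _ _).obj
        (((ModuleCat.restrictScalars.{u} φ).mapHomologicalComplex _).obj K)) :=
    ObjectProperty.prop_of_isZero _ hX
  rw [HomotopyCategory.quotient_obj_mem_subcategoryAcyclic_iff_exactAt] at h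
  intro n
  have h' := h n
  rw [HomologicalComplex.exactAt_iff] at h' ⊢
  exact (ShortComplex.exact_map_iff_of_faithful _ (ModuleCat.restrictScalars.{u} φ)).1 h'

/-- The quotient functor `Ho(B, A) ⥤ D(B)`. -/
noncomputable def hoRelToDerived [HasDerivedCategory.{w₁} (ModuleCat.{u} B)] :
    HoRel φ ⥤ DerivedCategory (ModuleCat.{u} B) :=
  Localization.Construction.lift DerivedCategory.Qh (fun _ _ f hf =>
    Localization.inverts DerivedCategory.Qh
      (HomotopyCategory.subcategoryAcyclic (ModuleCat.{u} B)).trW f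
      (ObjectProperty.trW_monotone (resKernel_le_acyclic φ) f hf))

end

/-- Bounded complexes of finitely generated projective modules, `Comp^b(A-proj)`. -/
def IsBoundedProj {A : Type u} [Ring A] (K : CochainComplex (ModuleCat.{u} A) ℤ) : Prop :=
  (∃ a b : ℤ, ∀ i : ℤ, i < a ∨ b < i → IsZero (K.X i)) ∧
    ∀ i : ℤ, Module.Finite A (K.X i) ∧ Module.Projective A (K.X i)

/-- Perfect objects of `D(A)`: those isomorphic to a bounded complex of finitely generated
projective modules. -/
def IsPerfect {A : Type u} [Ring A] [HasDerivedCategory.{w₁} (ModuleCat.{u} A)]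
    (X : DerivedCategory (ModuleCat.{u} A)) : Prop :=
  ∃ K : CochainComplex (ModuleCat.{u} A) ℤ,
    IsBoundedProj K ∧ Nonempty (X ≅ DerivedCategory.Q.obj K)

variable {A B : Type u} [Ring A] [Ring B] (φ : A →+* B)

/-- The objects of `Ho(B, A)` that are complexes `C` of `B`-modules such that the complex `Res_A C`
is a bounded complex of finitely generated projective `A`-modules. -/
def resBoundedProj : ObjectProperty (HoRel φ) := fun X =>
  ∃ C : CochainComplex (ModuleCat.{u} B) ℤ,
    IsBoundedProj (((ModuleCat.restrictScalars.{u} φ).mapHomologicalComplex _).obj C) ∧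
      X = (toHoRel φ).obj ((HomotopyCategory.quotient _ _).obj C)

/-- The objects of `Ho(B, A)` whose image in `Ho(A)` is isomorphic to a bounded complex of
finitely generated projective `A`-modules. -/
def resHoBoundedProj : ObjectProperty (HoRel φ) := fun X =>
  ∃ K : CochainComplex (ModuleCat.{u} A) ℤ,
    IsBoundedProj K ∧
      Nonempty ((hoRelRes φ).obj X ≅ (HomotopyCategory.quotient _ _).obj K)

/-- The objects of `D(B)` whose restriction to `A` is perfect. -/
def resPerfect [HasDerivedCategory.{w₁} (ModuleCat.{u} B)]
    [HasDerivedCategory.{w₂} (ModuleCat.{u} A)] :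
    ObjectProperty (DerivedCategory (ModuleCat.{u} B)) := fun X =>
  IsPerfect ((ModuleCat.restrictScalars.{u} φ).mapDerivedCategory.obj X)

/-- `F : 𝒞 ⥤ 𝒟` maps the full subcategory of `𝒞` given by `P` into the one of `𝒟` given by `Q`,
and the induced functor between these full subcategories is an equivalence. -/
def InducesEquivalence {C D : Type*} [Category* C] [Category* D] (F : C ⥤ D)
    (P : ObjectProperty C) (Q : ObjectProperty D) : Prop :=
  ∃ h : ∀ X : P.FullSubcategory, Q ((P.ι ⋙ F).obj X), (Q.lift (P.ι ⋙ F) h).IsEquivalence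

end RelHo

/-- The inclusion `kH → kΥ` of group algebras. -/
noncomputable abbrev groupAlgebraInclusion (k : Type u) [Field k] {Υ : Type u} [Group Υ]
    (H : Subgroup Υ) : MonoidAlgebra k H →+* MonoidAlgebra k Υ :=
  MonoidAlgebra.mapDomainRingHom k H.subtype

/-!
Throughout, `R = kΥ`, `S = kH` and `Res` is restriction along `S → R`.

*Full faithfulness.* Let `C` be a complex of `R`-modules such that `Res C` is homotopy equivalent to
a bounded complex of finitely generated projectives. Then `C` is exact in large degrees, so it has a
bounded above projective resolution `P → C`. As `R` is free over `S`, `Res P` also consists of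
projectives, so `Res P → Res C` is a quasi-isomorphism of K-projective complexes, hence a homotopy
equivalence, and `P ≅ C` in `Ho(R, S)` (`exists_isKProjective_of_resHoBoundedProj`). But `P` is
K-projective, so that morphisms out of `P` are the same in `Ho(R)`, in `Ho(R, S)` and in `D(R)`
(`hoRelToDerived_map_bijective`). The same resolutions give essential surjectivity when the
condition on `C` is read up to homotopy. None of this uses that `Υ / H` is good.

*Essential surjectivity for the literal condition.* The point is to represent an object `D` of
`D(R)` with perfect restriction by a bounded above complex `C` of *finite* `R`-modules that are
projective over `S`. Once this is done, `Res C` is homotopy equivalent to a bounded complex, and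
truncating `C` below at a sufficiently small degree replaces `C` by a bounded complex with the same
properties: the new module in the lowest degree is, over `S`, a retract of the next one
(`exists_isBoundedProj_truncGE`).

To find `C`, represent `D` by a bounded below complex `I` of injective modules; its cohomology is
finite. The complex `C → I` is built by descending induction (`exists_resolution`), and in each
degree one has to cover a module `W`, finite modulo the coboundaries `Bⁱ` of `I`, up to `Bⁱ` by a
finite `R`-module that is projective over `S`. The permutation modules `k[Υ / N]`, with `N` of
finite index and `N ∩ H = 1`, do this provided that each element of `W / Bⁱ` lifts to an element of
`W` with a stabilizer of finite index (`exists_finite_cover`). This lifting is governed by a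
cohomology class of degree one with values in `Bⁱ`, which must vanish on a subgroup of finite index.

So call a `Υ`-module *effaceable* if each class of positive degree on a subgroup of finite index
vanishes on a smaller subgroup of finite index (`IsEffaceable`). Injective modules are effaceable,
being retracts of coinduced ones (`isEffaceable_of_injective`), and effaceability is inherited by
quotients and extensions of effaceable modules. Finite modules are effaceable because `Υ / H` is
good (`IsGood.isEffaceable`): classes that come from the profinite completion die on an open
subgroup, the lemma of Shapiro extends this to the subgroups of finite index of `Υ / H`, and small
subgroups of finite index of `Υ` embed into `Υ / H`. For the last point, the extension of the
centralizer of `H` modulo `Z(H)` is classified by a class of degree two with finite coefficients,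
which vanishes on a subgroup of finite index (`IsGood.exists_finiteIndex_disjoint`). Now `Bⁱ = 0`
for small `i`, and `0 → Bⁱ → Zⁱ → Hⁱ → 0` and `0 → Zⁱ → Iⁱ → Bⁱ⁺¹ → 0` are exact, so that all `Bⁱ`
are effaceable by induction (`isEffaceable_coboundaries`).
-/

/-! ### Effaceable modules -/

namespace GoodGroup

variable {G M : Type u} [Group G] [AddCommGroup M]

/-- Deduced from the corresponding statement for `groupCohomology.inhomogeneousCochains`. -/
theorem differential_differential (ρ : G →* AddMonoid.End M) (n : ℕ) (f : (Fin n → G) → M) :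
    differential ρ (n + 1) (differential ρ n f) = 0 := by
  let σ : Representation (ULift.{u} ℤ) G M :=
    { toFun := fun g =>
        { toFun := ρ g, map_add' := map_add _, map_smul' := fun r x => map_zsmul (ρ g) r.down x }
      map_one' := by ext x; exact congrArg (fun φ : AddMonoid.End M => φ x) (map_one ρ)
      map_mul' := fun g h => by
        ext x
        exact congrArg (fun φ : AddMonoid.End M => φ x) (map_mul ρ g h) }
  have hd (n : ℕ) (f : (Fin n → G) → M) :
      (inhomogeneousCochains.d (Rep.of σ) n).hom f = differential ρ n f := by
    have h (j : ℕ) (x : M) : (-1 : ULift.{u} ℤ) ^ j • x = (-1 : ℤ) ^ j • x := by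
      rcases neg_one_pow_eq_or (ULift.{u} ℤ) j with h1 | h1 <;>
      rcases Nat.even_or_odd j with h2 | h2 <;> simp [h2]
    ext g
    exact congrArg₂ (· + ·) rfl (Finset.sum_congr rfl fun j _ => h _ _)
  have h := congrArg (fun φ => φ.hom f)
    (groupCohomology.inhomogeneousCochains.d_comp_d (A := Rep.of σ) (n := n))
  rw [← hd, ← hd]
  exact h

theorem differential_comp {M' : Type u} [AddCommGroup M'] (ρ : G →* AddMonoid.End M)
    (ρ' : G →* AddMonoid.End M') (φ : M →+ M') (hφ : ∀ g m, φ (ρ g m) = ρ' g (φ m)) (n : ℕ)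
    (f : (Fin n → G) → M) :
    differential ρ' n (φ ∘ f) = φ ∘ differential ρ n f := by
  ext g
  simp [differential, hφ, map_sum, map_zsmul]

/-- The filter on `Fin n → G` of the sets that contain `Nⁿ` for some subgroup `N` of finite
index. Germs along it encode the colimit of the cochains on the subgroups of finite index. -/
def finiteIndexFilter (G : Type u) [Group G] (n : ℕ) : Filter (Fin n → G) where
  sets := {s | ∃ N : Subgroup G, N.FiniteIndex ∧ ∀ g : Fin n → G, (∀ i, g i ∈ N) → g ∈ s}
  univ_sets := ⟨⊤, inferInstance, fun _ _ => trivial⟩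
  sets_of_superset := fun ⟨N, hN, h⟩ hst => ⟨N, hN, fun g hg => hst (h g hg)⟩
  inter_sets := fun ⟨N, _, h⟩ ⟨N', _, h'⟩ =>
    ⟨N ⊓ N', inferInstance, fun g hg => ⟨h g fun i => (hg i).1, h' g fun i => (hg i).2⟩⟩

theorem eventually_finiteIndexFilter {n : ℕ} {p : (Fin n → G) → Prop} :
    (∀ᶠ g in finiteIndexFilter G n, p g) ↔
      ∃ N : Subgroup G, N.FiniteIndex ∧ ∀ g : Fin n → G, (∀ i, g i ∈ N) → p g := Iff.rfl

theorem contractNth_mem (N : Subgroup G) {n : ℕ} {g : Fin (n + 1) → G} (hg : ∀ i, g i ∈ N)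
    (j : Fin (n + 1)) (i : Fin n) : Fin.contractNth j (· * ·) g i ∈ N := by
  rcases lt_trichotomy (i : ℕ) (j : ℕ) with h | h | h
  · rw [Fin.contractNth_apply_of_lt _ _ _ _ h]; exact hg _
  · rw [Fin.contractNth_apply_of_eq _ _ _ _ h]; exact N.mul_mem (hg _) (hg _)
  · rw [Fin.contractNth_apply_of_gt _ _ _ _ h]; exact hg _

theorem eventually_differential_eq (ρ : G →* AddMonoid.End M) {n : ℕ} {f f' : (Fin n → G) → M}
    (h : ∀ᶠ g in finiteIndexFilter G n, f g = f' g) :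
    ∀ᶠ g in finiteIndexFilter G (n + 1), differential ρ n f g = differential ρ n f' g := by
  obtain ⟨N, hN, h⟩ := h
  refine ⟨N, hN, fun g hg => ?_⟩
  have h1 : f (fun i => g i.succ) = f' (fun i => g i.succ) := h _ fun i => hg _
  have h2 (j : Fin (n + 1)) : f (Fin.contractNth j (· * ·) g) = f' (Fin.contractNth j (· * ·) g) :=
    h _ (contractNth_mem N hg j)
  simp [differential, h1, h2]

/-- The `G`-module `(M, ρ)` is *effaceable* if the colimit of the cohomology groups `Hⁿ(N, M)` over
the subgroups `N` of finite index of `G` vanishes for `n > 0`. Cochains on `N` are represented by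
arbitrary functions on `Gⁿ`, of which only the germ along `finiteIndexFilter` matters. -/
def IsEffaceable (ρ : G →* AddMonoid.End M) : Prop :=
  ∀ (n : ℕ) (f : (Fin (n + 1) → G) → M),
    (∀ᶠ g in finiteIndexFilter G (n + 2), differential ρ (n + 1) f g = 0) →
      ∃ c : (Fin n → G) → M,
        ∀ᶠ g in finiteIndexFilter G (n + 1), f g = differential ρ n c g

section ShortExact

variable {A B C : Type u} [AddCommGroup A] [AddCommGroup B] [AddCommGroup C]
  {α : G →* AddMonoid.End A} {β : G →* AddMonoid.End B} {γ : G →* AddMonoid.End C}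
  {i : A →+ B} {p : B →+ C}

theorem exists_lift_of_eventually_eq_zero (hi : ∀ g a, i (α g a) = β g (i a))
    (hi' : Function.Injective i) (hip : ∀ b, p b = 0 → b ∈ i.range) {n : ℕ} (b : (Fin n → G) → B)
    (hb : ∀ᶠ g in finiteIndexFilter G n, p (b g) = 0)
    (hdb : ∀ᶠ g in finiteIndexFilter G (n + 1), differential β n b g = 0) :
    ∃ a : (Fin n → G) → A, (∀ᶠ g in finiteIndexFilter G n, b g = i (a g)) ∧
      ∀ᶠ g in finiteIndexFilter G (n + 1), differential α n a g = 0 := by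
  have h (g : Fin n → G) : ∃ a, p (b g) = 0 → b g = i a := by
    by_cases h0 : p (b g) = 0
    · obtain ⟨a, ha⟩ := hip _ h0
      exact ⟨a, fun _ => ha.symm⟩
    · exact ⟨0, fun h => absurd h h0⟩
  choose a ha using h
  have hba : ∀ᶠ g in finiteIndexFilter G n, b g = i (a g) := hb.mono fun g hg => ha g hg
  refine ⟨a, hba, ?_⟩
  filter_upwards [eventually_differential_eq β hba, hdb] with g hg hg'
  apply hi'
  rw [map_zero, ← hg', hg]
  exact (congrFun (differential_comp α β i hi n a) g).symm

/-- If `0 → A → B → C → 0` is exact with `A` effaceable, then cocycles of `C` lift to cocycles of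
`B` on a small enough subgroup, as the connecting homomorphism takes values in the cohomology of
`A`. -/
theorem IsEffaceable.exists_lift (hα : IsEffaceable α) (hi : ∀ g a, i (α g a) = β g (i a))
    (hp : ∀ g b, p (β g b) = γ g (p b)) (hi' : Function.Injective i)
    (hip : ∀ b, p b = 0 ↔ b ∈ i.range) (hp' : Function.Surjective p) {n : ℕ}
    (c : (Fin n → G) → C)
    (hc : ∀ᶠ g in finiteIndexFilter G (n + 1), differential γ n c g = 0) :
    ∃ b : (Fin n → G) → B, (∀ g, p (b g) = c g) ∧
      ∀ᶠ g in finiteIndexFilter G (n + 1), differential β n b g = 0 := by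
  choose s hs using hp'
  have hpb : p ∘ (s ∘ c) = c := funext fun g => hs _
  have h1 : ∀ᶠ g in finiteIndexFilter G (n + 1), p (differential β n (s ∘ c) g) = 0 := by
    filter_upwards [hc] with g hg
    rw [← hg, ← congrArg (differential γ n) hpb, differential_comp β γ p hp]
    rfl
  obtain ⟨a, ha, ha'⟩ := exists_lift_of_eventually_eq_zero hi hi' (fun b => (hip b).1) _ h1
    (.of_forall fun g => congrFun (differential_differential β n (s ∘ c)) g)
  obtain ⟨e, he⟩ := hα n a ha'
  refine ⟨s ∘ c - i ∘ e, fun g => ?_, ?_⟩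
  · simp [hs, (hip _).2 ⟨e g, rfl⟩]
  · filter_upwards [ha, he] with g hg hg'
    rw [map_sub, Pi.sub_apply, hg, hg', differential_comp α β i hi]
    simp

theorem IsEffaceable.of_quotient (hα : IsEffaceable α) (hβ : IsEffaceable β)
    (hi : ∀ g a, i (α g a) = β g (i a))
    (hp : ∀ g b, p (β g b) = γ g (p b)) (hi' : Function.Injective i)
    (hip : ∀ b, p b = 0 ↔ b ∈ i.range) (hp' : Function.Surjective p) : IsEffaceable γ := by
  intro n c hc
  obtain ⟨b, hb, hb'⟩ := hα.exists_lift hi hp hi' hip hp' c hc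
  obtain ⟨e, he⟩ := hβ n b hb'
  refine ⟨p ∘ e, ?_⟩
  filter_upwards [he] with g hg
  rw [← hb, hg, differential_comp β γ p hp]
  rfl

theorem IsEffaceable.of_extension (hα : IsEffaceable α) (hγ : IsEffaceable γ)
    (hi : ∀ g a, i (α g a) = β g (i a))
    (hp : ∀ g b, p (β g b) = γ g (p b)) (hi' : Function.Injective i)
    (hip : ∀ b, p b = 0 ↔ b ∈ i.range) (hp' : Function.Surjective p) : IsEffaceable β := by
  intro n b hb
  obtain ⟨c, hc⟩ := hγ n (p ∘ b) (by
    filter_upwards [hb] with g hg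
    rw [differential_comp β γ p hp, Function.comp_apply, hg, map_zero])
  choose s hs using hp'
  have hsc : p ∘ (s ∘ c) = c := funext fun g => hs _
  obtain ⟨a, ha, ha'⟩ := exists_lift_of_eventually_eq_zero hi hi' (fun b => (hip b).1)
    (b - differential β n (s ∘ c)) (by
      filter_upwards [hc] with g hg
      have h : p (differential β n (s ∘ c) g) = differential γ n c g := by
        conv_rhs => rw [← hsc, differential_comp β γ p hp]
        rfl
      rw [Pi.sub_apply, map_sub, h, ← hg, Function.comp_apply, sub_self])
    (by
      filter_upwards [hb] with g hg
      rw [map_sub, differential_differential, sub_zero, hg])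
  obtain ⟨e, he⟩ := hα n a ha'
  refine ⟨s ∘ c + i ∘ e, ?_⟩
  filter_upwards [ha, he] with g hg hg'
  rw [map_add, differential_comp α β i hi, Pi.add_apply, Function.comp_apply, ← hg', ← hg]
  simp

end ShortExact

theorem IsEffaceable.of_retract {A B : Type u} [AddCommGroup A] [AddCommGroup B]
    {α : G →* AddMonoid.End A} {β : G →* AddMonoid.End B} (hβ : IsEffaceable β) (i : A →+ B)
    (r : B →+ A) (hi : ∀ g a, i (α g a) = β g (i a)) (hr : ∀ g b, r (β g b) = α g (r b))
    (hri : ∀ a, r (i a) = a) : IsEffaceable α := by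
  intro n f hf
  obtain ⟨c, hc⟩ := hβ n (i ∘ f) (by
    filter_upwards [hf] with g hg
    rw [differential_comp α β i hi, Function.comp_apply, hg, map_zero])
  refine ⟨r ∘ c, ?_⟩
  filter_upwards [hc] with g hg
  rw [differential_comp β α r hr, Function.comp_apply, ← hg, Function.comp_apply, hri]

/-- The coinduced `G`-module of functions `G → M`, with `G` acting by right translation. -/
def coind (G M : Type u) [Group G] [AddCommGroup M] : G →* AddMonoid.End (G → M) where
  toFun g := { toFun := fun φ x => φ (x * g), map_zero' := rfl, map_add' := fun _ _ => rfl }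
  map_one' := by
    ext φ x
    exact congrArg φ (mul_one x)
  map_mul' g h := by
    ext φ x
    exact congrArg φ (mul_assoc x g h).symm

theorem coind_apply (g x : G) (φ : G → M) : coind G M g φ x = φ (x * g) := rfl

/-- An `N`-equivariant map `G → N` for right translations, given by a choice of representatives of
the left cosets of `N`. -/
theorem exists_transversal_right (N : Subgroup G) :
    ∃ τ : G → G, (∀ x, τ x ∈ N) ∧ ∀ x, ∀ n ∈ N, τ (x * n) = τ x * n := by
  refine ⟨fun x => (Quotient.out (QuotientGroup.mk x : G ⧸ N))⁻¹ * x, fun x => ?_,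
    fun x n hn => ?_⟩
  · exact QuotientGroup.eq.1 (QuotientGroup.out_eq' _)
  · have : (QuotientGroup.mk (x * n) : G ⧸ N) = QuotientGroup.mk x := by simp [hn]
    simp only [this, mul_assoc]

/-- A map `τ : G → N` that commutes with right translation by `N` yields a contracting homotopy of
the cochains on `N` with values in the functions `G → M`. -/
theorem isEffaceable_coind (G M : Type u) [Group G] [AddCommGroup M] :
    IsEffaceable (coind G M) := by
  rintro n f ⟨N, hN, hf⟩
  obtain ⟨τ, hτ, hτ'⟩ := exists_transversal_right N
  refine ⟨fun g x => f (Fin.cons (τ x) g) (x * (τ x)⁻¹), N, hN, fun g hg => ?_⟩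
  ext x
  have h := congrFun (hf (Fin.cons (τ x) g) (fun i => by
    refine Fin.cases ?_ (fun i => ?_) i <;> simp [hτ, hg])) (x * (τ x)⁻¹)
  have hcons (j : Fin (n + 1)) :
      Fin.contractNth j.succ (· * ·) (Fin.cons (τ x) g : Fin (n + 2) → G) =
        Fin.cons (τ x) (Fin.contractNth j (· * ·) g) := by
    ext i
    refine Fin.cases ?_ (fun i => ?_) i
    · simp [Fin.contractNth]
    · simp [Fin.contractNth]
  have hcons0 : Fin.contractNth 0 (· * ·) (Fin.cons (τ x) g : Fin (n + 2) → G) =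
      Fin.cons (τ x * g 0) (fun i => g i.succ) := by
    ext i
    refine Fin.cases ?_ (fun i => ?_) i <;> simp [Fin.contractNth]
  simp only [differential, AddMonoidHom.coe_mk, ZeroHom.coe_mk, Fin.cons_zero, Fin.cons_succ,
    Pi.add_apply, Fin.sum_univ_succ (n := n + 1), Finset.sum_apply, Pi.smul_apply,
    hcons, hcons0, coind_apply, hτ' x _ (hg 0), inv_mul_cancel_right, mul_inv_rev,
    Pi.zero_apply, Fin.val_succ, pow_succ _ (_ + 1), mul_neg_one, neg_smul,
    Finset.sum_neg_distrib] at h ⊢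
  simp only [Pi.neg_apply, Finset.sum_apply, Pi.smul_apply, Fin.val_zero, zero_add, pow_one,
    neg_smul, one_smul] at h
  rw [show x * g 0 * ((g 0)⁻¹ * (τ x)⁻¹) = x * (τ x)⁻¹ by group, ← sub_eq_zero, ← h]
  abel

/-! ### Cohomology of good groups with finite coefficients -/

theorem finiteIndex_comap {G N : Type*} [Group G] [Group N] (ι : N →* G) (M : Subgroup G)
    [M.FiniteIndex] : (M.comap ι).FiniteIndex := by
  have : M.IsFiniteRelIndex ι.range := Subgroup.isFiniteRelIndex_of_finiteIndex
  exact ⟨by rw [Subgroup.index_comap]; exact Subgroup.relIndex_ne_zero⟩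

/-- The action of `G` on a finite module factors through a finite group, so it extends to the
profinite completion. -/
theorem exists_completion_action {G M : Type u} [Group G] [AddCommGroup M] [Finite M]
    (ρ : G →* AddMonoid.End M) :
    ∃ σ : Completion G →* AddMonoid.End M, σ.comp (toCompletion G) = ρ ∧
      ∀ m : M, IsLocallyConstant fun g : Completion G => σ g m := by
  have : Finite (AddMonoid.End M) :=
    Finite.of_injective (fun φ => (φ : M → M)) DFunLike.coe_injective
  let P : ProfiniteGrp.{u} := ProfiniteGrp.ofFiniteGrp (FiniteGrp.of (AddMonoid.End M)ˣ)
  let f : GrpCat.of G ⟶ GrpCat.of P := GrpCat.ofHom (MonoidHom.toHomUnits ρ)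
  let l := ProfiniteGrp.ProfiniteCompletion.lift f
  have hP : DiscreteTopology P := ⟨rfl⟩
  refine ⟨(Units.coeHom (AddMonoid.End M)).comp l.hom.toMonoidHom, ?_, fun m => ?_⟩
  · ext g : 1
    have h := ProfiniteGrp.ProfiniteCompletion.lift_eta f
    have h' := congrArg (fun φ => (φ.hom g : (AddMonoid.End M)ˣ)) h
    exact congrArg Units.val h'
  · have h : IsLocallyConstant (l.hom : Completion G → P) :=
      (IsLocallyConstant.iff_continuous _).2 l.hom.continuous_toFun
    exact h.comp fun x : (AddMonoid.End M)ˣ => (x : AddMonoid.End M) m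

/-- A continuous cochain on the profinite completion is constant on a small subgroup. -/
theorem eventually_eq_of_isLocallyConstant {G M : Type u} [Group G] {n : ℕ}
    {c : (Fin n → Completion G) → M} (hc : IsLocallyConstant c) :
    ∀ᶠ g in finiteIndexFilter G n, c (toCompletion G ∘ g) = c 1 := by
  obtain ⟨v, hv, hv'⟩ := isOpen_pi_iff'.1 (hc {c 1}) 1 rfl
  have hV : IsOpen (⋂ i, v i) := isOpen_iInter_of_finite fun i => (hv i).1
  obtain ⟨U, hU⟩ := ProfiniteGrp.exist_openNormalSubgroup_sub_open_nhds_of_one hV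
    (Set.mem_iInter.2 fun i => (hv i).2)
  have hfin : U.toSubgroup.FiniteIndex := Subgroup.finiteIndex_of_finite_quotient
  refine ⟨(U.toSubgroup : Subgroup (Completion G)).comap (toCompletion G),
    finiteIndex_comap _ _, fun g hg => ?_⟩
  exact hv' fun i _ => Set.mem_iInter.1 (hU (hg i)) i

theorem differential_const {G M : Type u} [Group G] [AddCommGroup M]
    (ρ : G →* AddMonoid.End M) (n : ℕ) (m : M) (g : Fin (n + 1) → G) (hg : ρ (g 0) m = m) :
    differential ρ n (fun _ => m) g = if Even n then 0 else m := by
  have h (n : ℕ) : ∑ j : Fin n, (-1 : ℤ) ^ ((j : ℕ) + 1) • m = if Even n then 0 else -m := by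
    induction n with
    | zero => simp
    | succ n ih =>
      rw [Fin.sum_univ_castSucc]
      simp only [Fin.val_castSucc, ih, Fin.val_last, Nat.even_add_one]
      split_ifs with hn <;> simp [pow_succ, hn, Nat.not_even_iff_odd.1]
  simp only [differential, AddMonoidHom.coe_mk, ZeroHom.coe_mk, hg, h, Nat.even_add_one]
  split_ifs <;> simp

/-- Cocycles of positive degree of a good group with values in a finite module are coboundaries on a
small subgroup. -/
theorem IsGood.exists_eventually_eq_differential {G M : Type u} [Group G] [AddCommGroup M]
    [Finite M] (hG : IsGood G) (ρ : G →* AddMonoid.End M) (n : ℕ) (f : (Fin (n + 1) → G) → M)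
    (hf : differential ρ (n + 1) f = 0) :
    ∃ c : (Fin n → G) → M,
      ∀ᶠ g in finiteIndexFilter G (n + 1), f g = differential ρ n c g := by
  obtain ⟨σ, rfl, hσ⟩ := exists_completion_action ρ
  let _ : TopologicalSpace G := ⊥
  have : DiscreteTopology G := ⟨rfl⟩
  have hfc : f ∈ cocycles (σ.comp (toCompletion G)) (n + 1) := ⟨IsLocallyConstant.of_discrete f, hf⟩
  obtain ⟨x, hx⟩ := (hG M σ hσ (n + 1)).2 (QuotientAddGroup.mk ⟨f, hfc⟩)
  obtain ⟨⟨c, hc⟩, rfl⟩ := QuotientAddGroup.mk_surjective x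
  obtain ⟨e, -, he⟩ := QuotientAddGroup.eq.1 hx
  have he (g : Fin (n + 1) → G) :
      f g = c (toCompletion G ∘ g) + differential (σ.comp (toCompletion G)) n e g := by
    have h : differential (σ.comp (toCompletion G)) n e g = - c (toCompletion G ∘ g) + f g :=
      congrFun he g
    rw [h]; abel
  -- In odd degree, the value at `1` of a cocycle is zero, by the cocycle condition at `1`.
  have hc1 : c 1 = if Even (n + 1) then c 1 else 0 := by
    have h : differential σ (n + 1) c = 0 := hc.2
    have h := congrFun h 1
    have h0 : differential σ (n + 1) (fun _ => c 1) 1 = differential σ (n + 1) c 1 := by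
      have hj (j : Fin (n + 2)) :
          Fin.contractNth j (· * ·) (1 : Fin (n + 2) → Completion G) = 1 := by
        ext i : 1
        simp [Fin.contractNth]
      simp only [differential, AddMonoidHom.coe_mk, ZeroHom.coe_mk, hj]
      rfl
    rw [← h0, differential_const _ _ _ _ (by simp)] at h
    split_ifs with hn
    · rfl
    · rwa [if_neg hn] at h
  have hker : ∀ᶠ g in finiteIndexFilter G (n + 1), σ (toCompletion G (g 0)) (c 1) = c 1 := by
    have : Finite (AddMonoid.End M) :=
      Finite.of_injective (fun φ => (φ : M → M)) DFunLike.coe_injective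
    refine ⟨(MonoidHom.toHomUnits (σ.comp (toCompletion G))).ker, inferInstance, fun g hg => ?_⟩
    exact congrArg (fun φ : (AddMonoid.End M)ˣ => (φ : AddMonoid.End M) (c 1)) (hg 0)
  -- In even degree, a constant cocycle is the coboundary of a constant cochain.
  refine ⟨e + fun _ => if Even (n + 1) then c 1 else 0, ?_⟩
  filter_upwards [eventually_eq_of_isLocallyConstant hc.1, hker] with g hg hg'
  rw [he, map_add, Pi.add_apply, hg, add_comm, hc1]
  congr 1
  split_ifs with hn
  · rw [differential_const _ _ _ _ hg', if_neg]
    rwa [← Nat.even_add_one]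
  · exact (congrFun (map_zero (differential (σ.comp (toCompletion G)) n)) g).symm

/-- A retraction `G → N` that is equivariant for left translations by `N`. -/
theorem exists_transversal_left {G N : Type*} [Group G] [Group N] (ι : N →* G)
    (hι : Function.Injective ι) :
    ∃ τ : G → N, τ 1 = 1 ∧ ∀ n x, τ (ι n * x) = n * τ x := by
  obtain ⟨τ, hτ, hτ'⟩ := exists_transversal_right ι.range
  choose s hs using hτ
  refine ⟨fun x => (s x⁻¹)⁻¹ * s 1, by simp, fun n x => ?_⟩
  apply hι
  simp only [map_mul, map_inv, hs, mul_inv_rev]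
  rw [hτ' _ _ (inv_mem ⟨n, rfl⟩)]
  simp [mul_assoc]

/-- The functions `G → A` that are invariant under left translation by `N`: the module coinduced
from the trivial `N`-module `A`. -/
def invariantFunctions {G N : Type u} [Group G] [Group N] (ι : N →* G) (A : Type u)
    [AddCommGroup A] : AddSubgroup (G → A) where
  carrier := {φ | ∀ n x, φ (ι n * x) = φ x}
  zero_mem' _ _ := rfl
  add_mem' h h' n x := congrArg₂ (· + ·) (h n x) (h' n x)
  neg_mem' h n x := congrArg Neg.neg (h n x)

/-- The action of `G` on `invariantFunctions ι A` by right translation. -/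
def invariantFunctionsAction {G N : Type u} [Group G] [Group N] (ι : N →* G) (A : Type u)
    [AddCommGroup A] : G →* AddMonoid.End (invariantFunctions ι A) where
  toFun g :=
    { toFun := fun φ => ⟨coind G A g φ, fun n x => by
        rw [coind_apply, mul_assoc, φ.2 n]
        rfl⟩
      map_zero' := rfl
      map_add' := fun _ _ => rfl }
  map_one' := by
    ext φ : 2
    exact congrArg (fun ψ : AddMonoid.End (G → A) => ψ φ) (map_one (coind G A))
  map_mul' g h := by
    ext φ : 2
    exact congrArg (fun ψ : AddMonoid.End (G → A) => ψ φ) (map_mul (coind G A) g h)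

theorem finite_invariantFunctions {G N : Type u} [Group G] [Group N] (ι : N →* G)
    (hfin : ι.range.FiniteIndex) (A : Type u) [AddCommGroup A] [Finite A] :
    Finite (invariantFunctions ι A) := by
  refine Finite.of_injective
    (fun φ => fun q : G ⧸ ι.range => (φ : G → A) (Quotient.out q)⁻¹) fun φ ψ h => ?_
  ext x
  obtain ⟨n, hn⟩ : (Quotient.out (QuotientGroup.mk x⁻¹ : G ⧸ ι.range))⁻¹ * x⁻¹ ∈ ι.range :=
    QuotientGroup.eq.1 (QuotientGroup.out_eq' _)
  have hx : ι n * x = (Quotient.out (QuotientGroup.mk x⁻¹ : G ⧸ ι.range))⁻¹ := by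
    rw [hn]; group
  rw [← φ.2 n, ← ψ.2 n, hx]
  exact congrFun h _

/-- For `τ : G → N`, the map `Gⁿ → Nⁿ` on inhomogeneous coordinates that is induced by applying `τ`
to each of the homogeneous coordinates `x, x g₀, x g₀ g₁, …`. -/
def transfer {G N : Type*} [Group G] [Group N] (τ : G → N) {n : ℕ} (x : G) (g : Fin n → G) :
    Fin n → N :=
  fun i => (τ (x * Fin.partialProd g i.castSucc))⁻¹ * τ (x * Fin.partialProd g i.succ)

section
variable {G N : Type*} [Group G] [Group N] (τ : G → N) {n : ℕ} (x : G) (g : Fin (n + 1) → G)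

theorem transfer_tail :
    transfer τ (x * g 0) (fun i => g i.succ) = fun i => transfer τ x g i.succ := by
  ext i
  simp only [transfer, ← Fin.succ_castSucc, Fin.partialProd_succ' g]
  simp only [Fin.tail_def, mul_assoc]

theorem transfer_contractNth (j : Fin (n + 1)) :
    transfer τ x (Fin.contractNth j (· * ·) g) = Fin.contractNth j (· * ·) (transfer τ x g) := by
  have h (i : Fin (n + 2)) :
      Fin.partialProd (transfer τ x g) i = (τ x)⁻¹ * τ (x * Fin.partialProd g i) := by
    have := congrFun (Fin.partialProd_left_inv fun i => τ (x * Fin.partialProd g i)) i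
    simp at this
    rw [← this]
    simp
    rfl
  ext k
  rw [← Fin.inv_partialProd_mul_eq_contractNth, h, h]
  simp only [transfer, Fin.partialProd_contractNth, Function.comp_apply, Fin.succ_succAbove_succ]
  group

end

/-- Cocycles of positive degree of a subgroup `N` of finite index of a good group with values in a
finite trivial module `A` are coboundaries on a small subgroup. By the argument of the lemma of
Shapiro, such a cocycle is the restriction to `N`, evaluated at `1`, of a cocycle of `G` with values
in the coinduced module, which is finite. -/
theorem IsGood.exists_eventually_eq_differential_of_injective {G N A : Type u} [Group G] [Group N]
    [AddCommGroup A] [Finite A] (hG : IsGood G) (ι : N →* G) (hι : Function.Injective ι)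
    (hfin : ι.range.FiniteIndex) (n : ℕ) (f : (Fin (n + 1) → N) → A)
    (hf : differential (1 : N →* AddMonoid.End A) (n + 1) f = 0) :
    ∃ c : (Fin n → N) → A,
      ∀ᶠ g in finiteIndexFilter N (n + 1), f g = differential 1 n c g := by
  obtain ⟨τ, hτ1, hτ⟩ := exists_transversal_left ι hι
  have := finite_invariantFunctions ι hfin A
  let F (g : Fin (n + 1) → G) : invariantFunctions ι A :=
    ⟨fun x => f (transfer τ x g), fun n x => by
      refine congrArg f (funext fun i => ?_)
      simp only [transfer, mul_assoc, hτ]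
      group⟩
  have hF : differential (invariantFunctionsAction ι A) (n + 1) F = 0 := by
    ext g x
    have h := congrFun hf (transfer τ x g)
    have h' := congrFun (congrFun (differential_comp (invariantFunctionsAction ι A) (coind G A)
      (invariantFunctions ι A).subtype (fun _ _ => rfl) (n + 1) F) g) x
    refine h'.symm.trans (Eq.trans ?_ h)
    simp [differential, coind_apply, F, transfer_tail, transfer_contractNth]
  obtain ⟨c, M, hM, hc⟩ := hG.exists_eventually_eq_differential _ n F hF
  refine ⟨fun g => (c (ι ∘ g) : G → A) 1, M.comap ι, finiteIndex_comap _ _, fun g hg => ?_⟩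
  have h := congrFun (congrArg Subtype.val (hc (ι ∘ g) hg)) 1
  have hg1 : transfer τ 1 (ι ∘ g) = g := by
    have hp (i : Fin (n + 2)) : Fin.partialProd (ι ∘ g) i = ι (Fin.partialProd g i) := by
      induction i using Fin.induction with
      | zero => simp
      | succ i ih => simp [Fin.partialProd_succ, ih]
    have hτι (y : N) : τ (ι y) = y := by
      rw [← mul_one (ι y), hτ, hτ1, mul_one]
    ext i
    rw [transfer, one_mul, one_mul, hp, hp, hτι, hτι, Fin.partialProd_right_inv]
  have hg2 : f g = (F (ι ∘ g) : G → A) 1 := congrArg f hg1.symm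
  have h' := congrFun (congrFun (differential_comp (invariantFunctionsAction ι A) (coind G A)
    (invariantFunctions ι A).subtype (fun _ _ => rfl) n c) (ι ∘ g)) 1
  refine (hg2.trans h).trans (h'.symm.trans ?_)
  have h0 (φ : invariantFunctions ι A) : (φ : G → A) (ι (g 0)) = (φ : G → A) 1 := by
    rw [← φ.2 (g 0) 1, mul_one]
  simp only [differential, AddMonoidHom.coe_mk, ZeroHom.coe_mk, Pi.add_apply, coind_apply,
    Finset.sum_apply, Pi.smul_apply, Function.comp_apply, one_mul, AddSubgroup.coe_subtype, h0,
    Fin.comp_contractNth _ _ (map_mul ι), MonoidHom.one_apply, AddMonoid.End.coe_one, id]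
  rfl

theorem finiteIndex_of_finiteIndex_map {Υ : Type*} [Group Υ] (H : Subgroup Υ) [H.Normal] [Finite H]
    (N : Subgroup Υ) (hN : (N.map (QuotientGroup.mk' H)).FiniteIndex) : N.FiniteIndex := by
  have h := hN.index_ne_zero
  rw [Subgroup.index_map, QuotientGroup.ker_mk'] at h
  have hJ : (N ⊔ H).FiniteIndex := ⟨left_ne_zero_of_mul h⟩
  rw [Subgroup.finiteIndex_iff_finite_quotient]
  refine Finite.of_surjective
    (fun q : H × (Υ ⧸ (N ⊔ H)) => (QuotientGroup.mk (Quotient.out q.2 * q.1) : Υ ⧸ N)) fun x => ?_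
  obtain ⟨x, rfl⟩ := QuotientGroup.mk_surjective x
  have hx : (Quotient.out (QuotientGroup.mk x : Υ ⧸ (N ⊔ H)))⁻¹ * x ∈ H ⊔ N := by
    rw [sup_comm]
    exact QuotientGroup.eq.1 (QuotientGroup.out_eq' _)
  obtain ⟨y, hy, n, hn, hyn⟩ := Subgroup.mem_sup_of_normal_left.1 hx
  refine ⟨(⟨y, hy⟩, QuotientGroup.mk x), QuotientGroup.eq.2 ?_⟩
  have : (Quotient.out (QuotientGroup.mk x : Υ ⧸ (N ⊔ H)) * y)⁻¹ * x = n := by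
    rw [mul_inv_rev, mul_assoc, ← hyn, inv_mul_cancel_left]
  simpa only [this] using hn

/-- The centralizer `C` of `H` is an extension of a subgroup `G₀` of finite index of `Υ / H` by the
center of `H`. Its class becomes trivial on a subgroup `G₁` of finite index, and the image of a
splitting over `G₁` is a subgroup of finite index of `Υ` that meets `H` trivially. -/
theorem IsGood.exists_finiteIndex_disjoint {Υ : Type u} [Group Υ] (H : Subgroup Υ) [H.Normal]
    [Finite H] (hG : IsGood (Υ ⧸ H)) : ∃ N : Subgroup Υ, N.FiniteIndex ∧ Disjoint N H := by
  have : Finite (MulAut H) := Finite.of_injective (fun φ => (φ : H → H)) DFunLike.coe_injective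
  set C : Subgroup Υ := (MulAut.conjNormal (H := H)).ker
  have hCfin : C.FiniteIndex := inferInstance
  have hcomm {c h : Υ} (hc : c ∈ C) (hh : h ∈ H) : c * h = h * c := by
    have h1 := congrArg (fun φ : MulAut H => (φ ⟨h, hh⟩ : Υ)) (MonoidHom.mem_ker.1 hc)
    simpa [mul_inv_eq_iff_eq_mul] using h1
  set G₀ : Subgroup (Υ ⧸ H) := C.map (QuotientGroup.mk' H)
  have hG₀fin : G₀.FiniteIndex := ⟨fun h0 => hCfin.index_ne_zero
    (Nat.eq_zero_of_zero_dvd (h0 ▸ C.index_map_dvd (QuotientGroup.mk'_surjective H)))⟩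
  -- A section `σ` of `C → G₀`, with the associated factor set `F`.
  choose σ hσC hσ using fun g : G₀ => g.2
  have hσH (g h : G₀) : σ g * σ h * (σ (g * h))⁻¹ ∈ H := by
    refine (QuotientGroup.eq_one_iff (N := H) _).1 ?_
    change QuotientGroup.mk' H (σ g * σ h * (σ (g * h))⁻¹) = 1
    rw [map_mul, map_mul, map_inv, hσ, hσ, hσ, Subgroup.coe_mul, mul_inv_cancel]
  let _ : CommGroup (Subgroup.center H) :=
    { (inferInstance : Group (Subgroup.center H)) with
      mul_comm := fun a b => Subtype.ext (Subgroup.mem_center_iff.1 b.2 a) }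
  let F (g h : G₀) : Additive (Subgroup.center H) :=
    Additive.ofMul ⟨⟨σ g * σ h * (σ (g * h))⁻¹, hσH _ _⟩,
      Subgroup.mem_center_iff.2 fun h => Subtype.ext
        (hcomm (C.mul_mem (C.mul_mem (hσC _) (hσC _)) (C.inv_mem (hσC _))) h.2).symm⟩
  have hF (g h : G₀) : (((F g h).toMul : H) : Υ) = σ g * σ h * (σ (g * h))⁻¹ := rfl
  have hFc (g h k : G₀) : F h k + F g (h * k) = F g h + F (g * h) k := by
    apply Additive.toMul.injective
    ext
    simp only [toMul_add, Subgroup.coe_mul, hF]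
    have h1 := hcomm (hσC g) (hσH h k)
    calc _ = (σ h * σ k * (σ (h * k))⁻¹ * σ g) * σ (h * k) * (σ (g * (h * k)))⁻¹ := by group
      _ = _ := by rw [← h1, mul_assoc g h k]; group
  let f (g : Fin 2 → G₀) : Additive (Subgroup.center H) := F (g 0) (g 1)
  have hf : differential (1 : G₀ →* AddMonoid.End (Additive (Subgroup.center H))) 2 f = 0 := by
    ext g : 1
    have h1 := hFc (g 0) (g 1) (g 2)
    have h2 : F (g 1) (g 2) +
        (-F (g 0 * g 1) (g 2) + F (g 0) (g 1 * g 2) + -F (g 0) (g 1)) = 0 := by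
      rw [eq_sub_of_add_eq h1]; abel
    refine Eq.trans ?_ h2
    simp [differential, Fin.sum_univ_three, f, Fin.contractNth]
  obtain ⟨c, G₁, hG₁, hc⟩ := hG.exists_eventually_eq_differential_of_injective G₀.subtype
    Subtype.val_injective (by rwa [Subgroup.range_subtype]) 1 f hf
  -- The cochain `ψ` that trivializes `F` on `G₁` corrects `σ` to a homomorphism `s` on `G₁`.
  let ψ (g : G₀) : Subgroup.center H := (c fun _ => g).toMul
  have hψ (g h : G₀) (hg : g ∈ G₁) (hh : h ∈ G₁) :
      σ g * σ h * (σ (g * h))⁻¹ = ψ h * (ψ (g * h))⁻¹ * ψ g := by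
    have h1 := hc ![g, h] (by simp [Fin.forall_fin_two, hg, hh])
    have h2 : F g h = c (fun _ => h) + (-c (fun _ => g * h) + c fun _ => g) := by
      refine Eq.trans h1 ?_
      have h3 (j : Fin 2) : Fin.contractNth j (· * ·) ![g, h] =
          fun _ => if j = 0 then g * h else g := by
        ext i : 1
        fin_cases j <;> fin_cases i <;> simp [Fin.contractNth]
      simp [differential, h3]
    rw [← hF, h2]
    simp [ψ, mul_assoc]
  let s : G₁ →* Υ := MonoidHom.mk' (fun g => σ g * ((ψ g : H) : Υ)⁻¹) fun g h => by
    have h1 := hψ g h g.2 h.2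
    have h2 (x y : G₀) : Commute (σ x) ((ψ y : H) : Υ) := hcomm (hσC x) (ψ y : H).2
    have h3 : Commute ((ψ (g * h : G₀) : H) : Υ)⁻¹ ((ψ h : H) : Υ) :=
      Commute.inv_left (congrArg (fun z : Subgroup.center H => ((z : H) : Υ))
        (mul_comm (ψ (g * h : G₀)) (ψ h)))
    have h4 : Commute ((ψ g : H) : Υ) (((ψ h : H) : Υ) * ((ψ (g * h : G₀) : H) : Υ)⁻¹) :=
      congrArg (fun z : Subgroup.center H => ((z : H) : Υ))
        (mul_comm (ψ g) (ψ h * (ψ (g * h : G₀))⁻¹))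
    rw [Subgroup.coe_inv, Subgroup.coe_inv, mul_inv_eq_iff_eq_mul] at h1
    symm
    calc σ g * ((ψ g : H) : Υ)⁻¹ * (σ h * ((ψ h : H) : Υ)⁻¹)
        = ((ψ g : H) : Υ)⁻¹ * (σ g * σ h) * ((ψ h : H) : Υ)⁻¹ := by
          rw [((h2 g g).inv_right).eq]; group
      _ = ((ψ g : H) : Υ)⁻¹ * ((ψ g : H) : Υ) * (((ψ h : H) : Υ) * ((ψ (g * h : G₀) : H) : Υ)⁻¹) *
          σ (g * h) * ((ψ h : H) : Υ)⁻¹ := by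
          rw [h1, ← h4.eq]; group
      _ = ((ψ (g * h : G₀) : H) : Υ)⁻¹ * (((ψ h : H) : Υ) * σ (g * h)) * ((ψ h : H) : Υ)⁻¹ := by
          rw [← h3.eq]; group
      _ = _ := by
          rw [← (h2 (g * h) h).eq, mul_assoc, mul_inv_cancel_right, (h2 _ _).inv_right.eq]
          rfl
  have hs (g : G₁) : QuotientGroup.mk' H (s g) = (g : G₀) := by
    have : QuotientGroup.mk' H ((ψ g : H) : Υ) = 1 :=
      (QuotientGroup.eq_one_iff (N := H) _).2 (ψ g : H).2
    simp only [s, MonoidHom.mk'_apply, map_mul, map_inv, this, hσ, inv_one, mul_one]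
  refine ⟨s.range, finiteIndex_of_finiteIndex_map H _ ?_, ?_⟩
  · have : s.range.map (QuotientGroup.mk' H) = G₁.map G₀.subtype := by
      ext x
      constructor
      · rintro ⟨_, ⟨g, rfl⟩, rfl⟩
        exact ⟨g, g.2, (hs g).symm⟩
      · rintro ⟨g, hg, rfl⟩
        exact ⟨s ⟨g, hg⟩, ⟨_, rfl⟩, hs ⟨g, hg⟩⟩
    rw [this]
    exact ⟨by
      rw [Subgroup.index_map_subtype]
      exact mul_ne_zero hG₁.index_ne_zero hG₀fin.index_ne_zero⟩
  · rw [Subgroup.disjoint_def]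
    rintro _ ⟨g, rfl⟩ hg
    have h1 := hs g
    have h2 : QuotientGroup.mk' H (s g) = 1 := (QuotientGroup.eq_one_iff _).2 hg
    have : g = 1 := Subtype.ext (Subtype.ext (h1.symm.trans h2))
    rw [this, map_one]

/-- Finite `Υ`-modules are effaceable if `Υ / H` is good and `H` is finite: small subgroups of `Υ`
act trivially on the module and embed into `Υ / H`. -/
theorem IsGood.isEffaceable {Υ : Type u} [Group Υ] (H : Subgroup Υ) [H.Normal] [Finite H]
    (hG : IsGood (Υ ⧸ H)) {M : Type u} [AddCommGroup M] [Finite M] (ρ : Υ →* AddMonoid.End M) :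
    IsEffaceable ρ := by
  rintro n f ⟨N₁, hN₁, hf⟩
  obtain ⟨N₂, hN₂, hN₂H⟩ := hG.exists_finiteIndex_disjoint H
  have : Finite (AddMonoid.End M) :=
    Finite.of_injective (fun φ => (φ : M → M)) DFunLike.coe_injective
  let N : Subgroup Υ := N₁ ⊓ N₂ ⊓ (MonoidHom.toHomUnits ρ).ker
  have hN : N.FiniteIndex := inferInstance
  have hρ (g : N) (m : M) : ρ g m = m :=
    congrArg (fun φ : (AddMonoid.End M)ˣ => (φ : AddMonoid.End M) m) g.2.2
  have hd (n : ℕ) (c : (Fin n → Υ) → M) (c' : (Fin n → N) → M)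
      (hc : ∀ g : Fin n → N, c (Subtype.val ∘ g) = c' g) (g : Fin (n + 1) → N) :
      differential ρ n c (Subtype.val ∘ g) = differential 1 n c' g := by
    have h1 (j : Fin (n + 1)) : Fin.contractNth j (· * ·) (Subtype.val ∘ g : Fin (n + 1) → Υ) =
        Subtype.val ∘ Fin.contractNth j (· * ·) g :=
      (Fin.comp_contractNth _ _ (map_mul N.subtype) j g).symm
    have h2 : (fun i => (Subtype.val ∘ g : Fin (n + 1) → Υ) (Fin.succ i)) =
        Subtype.val ∘ fun i => g (Fin.succ i) := rfl
    simp only [differential, AddMonoidHom.coe_mk, ZeroHom.coe_mk, h1, h2, hc]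
    simp [hρ]
  let ι : N →* Υ ⧸ H := (QuotientGroup.mk' H).comp N.subtype
  have hι : Function.Injective ι := by
    rw [injective_iff_map_eq_one]
    intro g hg
    exact Subtype.ext (Subgroup.disjoint_def.1 hN₂H g.2.1.2 ((QuotientGroup.eq_one_iff _).1 hg))
  have hιfin : ι.range.FiniteIndex := by
    rw [MonoidHom.range_comp, Subgroup.range_subtype]
    exact ⟨fun h0 => hN.index_ne_zero
      (Nat.eq_zero_of_zero_dvd (h0 ▸ N.index_map_dvd (QuotientGroup.mk'_surjective H)))⟩
  obtain ⟨c, N', hN', hc⟩ := hG.exists_eventually_eq_differential_of_injective ι hι hιfin n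
    (fun g => f (Subtype.val ∘ g)) (by
      ext g
      rw [← hd _ f _ (fun _ => rfl)]
      exact hf _ fun i => (g i).2.1.1)
  classical
  let e (g : Fin n → Υ) : M := if hg : ∀ i, g i ∈ N then c fun i => ⟨g i, hg i⟩ else 0
  have he (g : Fin n → N) : e (Subtype.val ∘ g) = c g := dif_pos fun i => (g i).2
  refine ⟨e, N'.map N.subtype, ⟨?_⟩, fun g hg => ?_⟩
  · rw [Subgroup.index_map_subtype]
    exact mul_ne_zero hN'.index_ne_zero hN.index_ne_zero
  · choose g' hg' hgg' using hg
    obtain rfl : Subtype.val ∘ g' = g := funext hgg'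
    exact (hc g' hg').trans (hd n e c he g').symm

end GoodGroup

/-! ### Modules over group algebras -/

namespace GroupModule
open GoodGroup

variable (k : Type u) [Field k] (Υ : Type u) [Group Υ]

/-- The action of `Υ` on a `kΥ`-module. -/
noncomputable def action (M : Type u) [AddCommGroup M] [Module (MonoidAlgebra k Υ) M] :
    Υ →* AddMonoid.End M :=
  (Module.toAddMonoidEnd (MonoidAlgebra k Υ) M).toMonoidHom.comp (MonoidAlgebra.of k Υ)

variable {k Υ}

theorem action_apply {M : Type u} [AddCommGroup M] [Module (MonoidAlgebra k Υ) M] (g : Υ) (m : M) :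
    action k Υ M g m = MonoidAlgebra.of k Υ g • m := rfl

/-- An additive map of `kΥ`-modules is linear if it commutes with the scalars in `Υ` and in `k`. -/
theorem map_smul_of_map_of_smul {M M' : Type*} [AddCommGroup M] [Module (MonoidAlgebra k Υ) M]
    [AddCommGroup M'] [Module (MonoidAlgebra k Υ) M'] (L : M →+ M')
    (hof : ∀ g m, L (MonoidAlgebra.of k Υ g • m) = MonoidAlgebra.of k Υ g • L m)
    (hk : ∀ (a : k) m,
      L (MonoidAlgebra.single (1 : Υ) a • m) = MonoidAlgebra.single (1 : Υ) a • L m)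
    (r : MonoidAlgebra k Υ) (m : M) : L (r • m) = r • L m := by
  induction r using MonoidAlgebra.induction_linear with
  | zero => simp
  | add x y hx hy => simp [add_smul, hx, hy]
  | single g a =>
    have : MonoidAlgebra.single g a = MonoidAlgebra.single 1 a * MonoidAlgebra.of k Υ g := by
      simp [MonoidAlgebra.of_apply]
    rw [this, mul_smul, hk, hof, mul_smul]

/-- An injective module is a retract of the module coextended from its restriction to `k`, which is
a coinduced `Υ`-module. -/
theorem isEffaceable_of_injective (M : ModuleCat.{u} (MonoidAlgebra k Υ)) [Injective M] :
    IsEffaceable (action k Υ M) := by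
  let f : k →+* MonoidAlgebra k Υ := MonoidAlgebra.singleOneRingHom
  let X := (ModuleCat.restrictScalars f).obj M
  let J := (ModuleCat.coextendScalars f).obj X
  let j : M ⟶ J := (ModuleCat.restrictCoextendScalarsAdj f).unit.app M
  have hj (m : M) (r : MonoidAlgebra k Υ) :
      ModuleCat.CoextendScalars.equiv f X (j m) r = r • m := rfl
  have : Mono j := by
    rw [ModuleCat.mono_iff_injective]
    intro m m' h
    rw [← one_smul (MonoidAlgebra k Υ) m, ← one_smul (MonoidAlgebra k Υ) m', ← hj, ← hj, h]
  let r : J ⟶ M := Injective.factorThru (𝟙 M) j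
  have hr (m : M) : r (j m) = m := by
    have : j ≫ r = 𝟙 M := Injective.comp_factorThru _ _
    exact congrArg (fun φ => φ.hom m) this
  -- A `k`-linear map `φ : kΥ → M` corresponds to the function `x ↦ φ x` on `Υ`.
  have hJ : IsEffaceable (action k Υ J) := by
    let e : J →+ (Υ → X) :=
      { toFun := fun φ x => ModuleCat.CoextendScalars.equiv f X φ (MonoidAlgebra.of k Υ x)
        map_zero' := rfl
        map_add' := fun _ _ => rfl }
    let e' : (Υ → X) →+ J :=
      { toFun := fun ψ => (ModuleCat.CoextendScalars.equiv f X).symm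
          { toFun := fun r : MonoidAlgebra k Υ => Finsupp.linearCombination k ψ r.coeff
            map_add' := fun r s => map_add (Finsupp.linearCombination k ψ) r.coeff s.coeff
            map_smul' := fun a (r : MonoidAlgebra k Υ) => by
              have : (f a * r).coeff = a • r.coeff := by
                ext x
                simp [f]
              refine (congrArg (Finsupp.linearCombination k ψ) this).trans ?_
              rw [map_smul]
              rfl }
        map_zero' := by
          apply (ModuleCat.CoextendScalars.equiv f X).injective
          refine LinearMap.ext fun r : MonoidAlgebra k Υ => ?_
          change Finsupp.linearCombination k (0 : Υ → X) r.coeff = 0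
          simp
        map_add' := fun ψ ψ' => by
          apply (ModuleCat.CoextendScalars.equiv f X).injective
          refine LinearMap.ext fun r : MonoidAlgebra k Υ => ?_
          change Finsupp.linearCombination k (ψ + ψ') r.coeff =
            Finsupp.linearCombination k ψ r.coeff + Finsupp.linearCombination k ψ' r.coeff
          simp [Finsupp.linearCombination_apply, Finsupp.sum, Finset.sum_add_distrib] }
    have he' (ψ : Υ → X) (r : MonoidAlgebra k Υ) :
        ModuleCat.CoextendScalars.equiv f X (e' ψ) r = Finsupp.linearCombination k ψ r.coeff := rfl
    have he (φ : J) (x : Υ) :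
        e φ x = ModuleCat.CoextendScalars.equiv f X φ (MonoidAlgebra.of k Υ x) := rfl
    refine (isEffaceable_coind Υ X).of_retract e e' (fun g φ => ?_) (fun g ψ => ?_) fun φ => ?_
    · ext x
      rw [coind_apply, he, he, map_mul]
      rfl
    · apply (ModuleCat.CoextendScalars.equiv f X).injective
      refine LinearMap.ext fun r : MonoidAlgebra k Υ => ?_
      rw [he']
      refine Eq.trans ?_ (he' ψ (r * MonoidAlgebra.of k Υ g)).symm
      induction r using MonoidAlgebra.induction_linear with
      | zero => simp
      | add x y hx hy => simp only [add_mul, MonoidAlgebra.coeff_add, map_add, hx, hy]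
      | single x a => simp [coind_apply]
    · apply (ModuleCat.CoextendScalars.equiv f X).injective
      refine LinearMap.ext fun r : MonoidAlgebra k Υ => ?_
      rw [he']
      induction r using MonoidAlgebra.induction_linear with
      | zero => exact (map_zero (Finsupp.linearCombination k (e φ))).trans (map_zero _).symm
      | add x y hx hy =>
        refine (map_add (Finsupp.linearCombination k (e φ)) _ _).trans ?_
        exact (congrArg₂ (· + ·) hx hy).trans (map_add _ _ _).symm
      | single x a =>
        have : (MonoidAlgebra.single x a : MonoidAlgebra k Υ) = f a * MonoidAlgebra.of k Υ x := by
          simp [f]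
        rw [MonoidAlgebra.coeff_single, Finsupp.linearCombination_single, this, he]
        exact (map_smul (ModuleCat.CoextendScalars.equiv f X φ) a _).symm
  exact hJ.of_retract j.hom.toAddMonoidHom r.hom.toAddMonoidHom
    (fun g m => j.hom.map_smul _ _) (fun g m => r.hom.map_smul _ _) hr

/-- If `H` embeds into `Q`, then `kQ` is projective over `kH`. The `kH`-module `kQ` is given here by
any module `X` that is isomorphic to it. -/
theorem projective_of_injective {H Q : Type u} [Group H] [Group Q] (φ : H →* Q)
    (hφ : Function.Injective φ) {X : Type u} [AddCommGroup X] [Module (MonoidAlgebra k H) X]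
    (e : X ≃+ MonoidAlgebra k Q)
    (he : ∀ r x, e (r • x) = MonoidAlgebra.mapDomainRingHom k φ r * e x) :
    Module.Projective (MonoidAlgebra k H) X := by
  obtain ⟨τ, -, hτ⟩ := exists_transversal_left φ hφ
  -- Writing `q = φ (τ q) * ρ q`, where `ρ q` depends only on the coset of `q`, splits the
  -- surjection of the free module on `Q` onto `X`.
  let ρ (q : Q) : Q := (φ (τ q))⁻¹ * q
  have hρ (h : H) (q : Q) : ρ (φ h * q) = ρ q := by simp [ρ, hτ, mul_assoc]
  let s : MonoidAlgebra k Q →+ (Q →₀ MonoidAlgebra k H) :=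
    (Finsupp.liftAddHom fun q => (Finsupp.singleAddHom (ρ q)).comp
      (MonoidAlgebra.singleAddHom (τ q))).comp MonoidAlgebra.coeffAddEquiv.toAddMonoidHom
  have hs (q : Q) (a : k) : s (MonoidAlgebra.single q a) =
      Finsupp.single (ρ q) (MonoidAlgebra.single (τ q) a) := by
    simp [s]
  let sX : X →ₗ[MonoidAlgebra k H] (Q →₀ MonoidAlgebra k H) :=
    { s.comp e.toAddMonoidHom with
      map_smul' := by
        refine map_smul_of_map_of_smul (s.comp e.toAddMonoidHom) (fun h x => ?_) fun a x => ?_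
        · change s (e _) = _ • s (e x)
          rw [he]
          induction e x using MonoidAlgebra.induction_linear with
          | zero => simp
          | add y z hy hz => simp only [mul_add, map_add, smul_add, hy, hz]
          | single q b => simp [hs, hτ, hρ]
        · change s (e _) = _ • s (e x)
          rw [he]
          induction e x using MonoidAlgebra.induction_linear with
          | zero => simp
          | add y z hy hz => simp only [mul_add, map_add, smul_add, hy, hz]
          | single q b => simp [hs] }
  let π : (Q →₀ MonoidAlgebra k H) →ₗ[MonoidAlgebra k H] X :=
    Finsupp.linearCombination _ fun q => e.symm (MonoidAlgebra.of k Q q)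
  refine Module.Projective.of_split sX π ?_
  ext x
  apply e.injective
  change e (π (s (e x))) = e x
  induction e x using MonoidAlgebra.induction_linear with
  | zero => simp
  | add y z hy hz => simp only [map_add, hy, hz]
  | single q b => simp [hs, π, he, ρ]

theorem finite_monoidAlgebra [Finite k] (Q : Type*) [Finite Q] :
    Finite (MonoidAlgebra k Q) :=
  Finite.of_injective (fun x => (x.coeff : Q → k))
    (DFunLike.coe_injective.comp MonoidAlgebra.coeff_injective)

variable (k) in
/-- The permutation module `k[Υ / N]`. -/
noncomputable abbrev permutationModule (N : Subgroup Υ) [N.Normal] :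
    ModuleCat.{u} (MonoidAlgebra k Υ) :=
  (ModuleCat.restrictScalars (MonoidAlgebra.mapDomainRingHom k (QuotientGroup.mk' N))).obj
    (ModuleCat.of _ (MonoidAlgebra k (Υ ⧸ N)))

theorem exists_permutationModule_map (N : Subgroup Υ) [N.Normal] {M : Type u} [AddCommGroup M]
    [Module (MonoidAlgebra k Υ) M] (m : M) (hm : ∀ g ∈ N, MonoidAlgebra.of k Υ g • m = m) :
    ∃ L : permutationModule k N →ₗ[MonoidAlgebra k Υ] M, m ∈ LinearMap.range L := by
  let L : MonoidAlgebra k (Υ ⧸ N) →+ M :=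
    (Finsupp.liftAddHom fun q =>
      (((smulAddHom (MonoidAlgebra k Υ) M).flip m).comp
        (MonoidAlgebra.singleAddHom (Quotient.out q)))).comp
      MonoidAlgebra.coeffAddEquiv.toAddMonoidHom
  have hL (q : Υ ⧸ N) (a : k) :
      L (MonoidAlgebra.single q a) = MonoidAlgebra.single (Quotient.out q) a • m := by
    simp [L]
  have hL' (g : Υ) (a : k) :
      L (MonoidAlgebra.single (QuotientGroup.mk g) a) = MonoidAlgebra.single g a • m := by
    obtain ⟨n, hn⟩ := QuotientGroup.mk_out_eq_mul N g
    have h : MonoidAlgebra.single (Quotient.out (QuotientGroup.mk g : Υ ⧸ N)) a =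
        MonoidAlgebra.single g a * MonoidAlgebra.of k Υ n := by
      rw [hn]
      simp
    rw [hL, h, mul_smul, hm _ n.2]
  have hlin : ∀ (r : MonoidAlgebra k Υ) (x : permutationModule k N), L (r • x) = r • L x := by
    refine map_smul_of_map_of_smul (M := permutationModule k N) L
      (fun g (x : MonoidAlgebra k (Υ ⧸ N)) => ?_) fun a (x : MonoidAlgebra k (Υ ⧸ N)) => ?_
    · change L (MonoidAlgebra.mapDomainRingHom k (QuotientGroup.mk' N) (MonoidAlgebra.of k Υ g) *
        x) = MonoidAlgebra.of k Υ g • L x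
      induction x using MonoidAlgebra.induction_linear with
      | zero => simp
      | add y z hy hz => simp only [mul_add, map_add, smul_add, hy, hz]
      | single q b =>
        obtain ⟨q, rfl⟩ := QuotientGroup.mk_surjective q
        simp [hL', smul_smul, ← QuotientGroup.mk_mul]
    · change L (MonoidAlgebra.mapDomainRingHom k (QuotientGroup.mk' N) (MonoidAlgebra.single 1 a) *
        x) = MonoidAlgebra.single 1 a • L x
      induction x using MonoidAlgebra.induction_linear with
      | zero => simp
      | add y z hy hz => simp only [mul_add, map_add, smul_add, hy, hz]
      | single q b =>
        obtain ⟨q, rfl⟩ := QuotientGroup.mk_surjective q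
        simp [hL', smul_smul]
  refine ⟨{ toFun := L, map_add' := map_add L, map_smul' := hlin },
    (MonoidAlgebra.single 1 1 : MonoidAlgebra k (Υ ⧸ N)), ?_⟩
  refine (hL' 1 1).trans ?_
  exact one_smul _ m

/-- The stabilizer of `m` contains a subgroup of finite index. -/
def IsSmooth (k : Type u) [Field k] {Υ M : Type u} [Group Υ] [AddCommGroup M]
    [Module (MonoidAlgebra k Υ) M] (m : M) : Prop :=
  ∃ N : Subgroup Υ, N.FiniteIndex ∧ ∀ g ∈ N, MonoidAlgebra.of k Υ g • m = m

/-- Finitely many smooth elements lie in the image of a finite module that is projective over `kH`,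
namely of a sum of copies of `k[Υ / N]`, for `N` small and with `N ∩ H = 1`. -/
theorem exists_finite_cover [Finite k] (H : Subgroup Υ) [H.Normal] [Finite H]
    (hG : IsGood (Υ ⧸ H)) {M : Type u} [AddCommGroup M] [Module (MonoidAlgebra k Υ) M]
    (S : Set M) (hS : S.Finite) (hsm : ∀ m ∈ S, IsSmooth k (Υ := Υ) m) :
    ∃ P : ModuleCat.{u} (MonoidAlgebra k Υ), Finite P ∧
      Module.Projective (MonoidAlgebra k H)
        ((ModuleCat.restrictScalars (groupAlgebraInclusion k H)).obj P) ∧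
      ∃ L : P →ₗ[MonoidAlgebra k Υ] M, S ⊆ LinearMap.range L := by
  have := hS.to_subtype
  obtain ⟨N₀, hN₀, hN₀H⟩ := hG.exists_finiteIndex_disjoint H
  choose N hN hNm using fun m : S => hsm m m.2
  let N' : Subgroup Υ := (N₀ ⊓ ⨅ m, N m).normalCore
  have hN' : N'.FiniteIndex :=
    have := Subgroup.finiteIndex_iInf hN
    inferInstance
  have hN'le : N' ≤ N₀ ⊓ ⨅ m, N m := Subgroup.normalCore_le _
  choose L x hx using fun m : S => exists_permutationModule_map N' (m : M) fun g hg =>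
    hNm m g ((Subgroup.mem_iInf.1 (hN'le hg).2) m)
  let P := permutationModule k N'
  have hP : Module.Projective (MonoidAlgebra k H)
      ((ModuleCat.restrictScalars (groupAlgebraInclusion k H)).obj P) := by
    refine projective_of_injective ((QuotientGroup.mk' N').comp H.subtype) ?_
      (AddEquiv.refl (MonoidAlgebra k (Υ ⧸ N'))) fun r x => ?_
    · rw [injective_iff_map_eq_one]
      intro h hh
      exact Subtype.ext (Subgroup.disjoint_def.1 hN₀H
        (hN'le ((QuotientGroup.eq_one_iff (N := N') _).1 hh)).1 h.2)
    · rw [MonoidAlgebra.mapDomainRingHom_comp]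
      rfl
  have hfin : Finite P := finite_monoidAlgebra (k := k) (Υ ⧸ N')
  refine ⟨ModuleCat.of _ (S →₀ P), Finite.of_injective (fun x : S →₀ P => (x : S → P))
      DFunLike.coe_injective, ?_,
    Finsupp.lsum ℕ L, fun m hm => ⟨Finsupp.single ⟨m, hm⟩ (x ⟨m, hm⟩), ?_⟩⟩
  · let e : (S →₀ (ModuleCat.restrictScalars (groupAlgebraInclusion k H)).obj P)
        ≃ₗ[MonoidAlgebra k H] (ModuleCat.restrictScalars (groupAlgebraInclusion k H)).obj
          (ModuleCat.of _ (S →₀ P)) :=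
      { AddEquiv.refl (S →₀ P) with map_smul' := fun r x => rfl }
    classical
    have : Module.Projective (MonoidAlgebra k H)
        (S →₀ (ModuleCat.restrictScalars (groupAlgebraInclusion k H)).obj P) :=
      Module.Projective.of_equiv (finsuppLequivDFinsupp (MonoidAlgebra k H)).symm
    exact Module.Projective.of_equiv e
  · simp [hx]

end GroupModule

/-! ### Resolutions of complexes of modules -/

namespace ModuleComplex

variable {A : Type u} [Ring A]

/-- The module of `i`-cocycles of `Y`. -/
abbrev cocycles (Y : CochainComplex (ModuleCat.{u} A) ℤ) (i : ℤ) : Submodule A (Y.X i) :=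
  LinearMap.ker (Y.d i (i + 1)).hom

/-- The module of `i`-coboundaries of `Y`. -/
abbrev coboundaries (Y : CochainComplex (ModuleCat.{u} A) ℤ) (i : ℤ) : Submodule A (Y.X i) :=
  LinearMap.range (Y.d (i - 1) i).hom

section
variable (Y : CochainComplex (ModuleCat.{u} A) ℤ)

theorem d_mem_coboundaries (i j : ℤ) (y : Y.X i) : (Y.d i j).hom y ∈ coboundaries Y j := by
  by_cases h : i + 1 = j
  · obtain rfl : i = j - 1 := by lia
    exact ⟨y, rfl⟩
  · rw [Y.shape i j h]
    exact zero_mem _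

theorem mem_coboundaries_succ {i : ℤ} {y : Y.X (i + 1)} :
    y ∈ coboundaries Y (i + 1) ↔ ∃ x, (Y.d i (i + 1)).hom x = y := by
  constructor
  · have h (j : ℤ) (hj : j = i) (h : y ∈ LinearMap.range (Y.d j (i + 1)).hom) :
        ∃ x, (Y.d i (i + 1)).hom x = y := by
      subst hj
      exact h
    exact h _ (by lia)
  · rintro ⟨x, rfl⟩
    exact d_mem_coboundaries Y _ _ x

theorem d_d_apply (i j l : ℤ) (y : Y.X i) : (Y.d j l).hom ((Y.d i j).hom y) = 0 :=
  congrArg (fun φ => φ.hom y) (Y.d_comp_d i j l)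

theorem coboundaries_le_cocycles (i : ℤ) : coboundaries Y i ≤ cocycles Y i := by
  rintro _ ⟨y, rfl⟩
  exact d_d_apply Y _ _ _ y

theorem exactAt_iff_cocycles_le (i : ℤ) : Y.ExactAt i ↔ cocycles Y i ≤ coboundaries Y i := by
  rw [Y.exactAt_iff' (i - 1) i (i + 1) (by simp) (by simp),
    ShortComplex.moduleCat_exact_iff_ker_sub_range]
  rfl

variable {Y} {C : CochainComplex (ModuleCat.{u} A) ℤ} (f : C ⟶ Y)

theorem quasiIso_of_cocycles
    (hsurj : ∀ i, ∀ z ∈ cocycles Y i, ∃ c ∈ cocycles C i, (f.f i).hom c - z ∈ coboundaries Y i)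
    (hinj : ∀ i, ∀ c ∈ cocycles C i, (f.f i).hom c ∈ coboundaries Y i → c ∈ coboundaries C i) :
    QuasiIso f := by
  refine ⟨fun i => ?_⟩
  rw [quasiIsoAt_iff_isIso_homologyMap]
  have hmono : Mono (HomologicalComplex.homologyMap f i) := by
    rw [HomologicalComplex.mono_homologyMap_iff_up_to_refinements f (i - 1) i (i + 1) (by simp)
      (by simp)]
    intro T x hx y hxy
    let T' := LinearMap.eqLocus (x.hom ∘ₗ LinearMap.fst A T (C.X (i - 1)))
      ((C.d (i - 1) i).hom ∘ₗ LinearMap.snd A T (C.X (i - 1)))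
    refine ⟨ModuleCat.of A T', ModuleCat.ofHom (LinearMap.fst _ _ _ ∘ₗ T'.subtype), ?_,
      ModuleCat.ofHom (LinearMap.snd _ _ _ ∘ₗ T'.subtype), ?_⟩
    · rw [ModuleCat.epi_iff_surjective]
      intro t
      obtain ⟨c, hc⟩ := hinj i (x.hom t) (LinearMap.mem_ker.2 (congrArg (fun φ => φ.hom t) hx))
        ⟨y.hom t, (congrArg (fun φ => φ.hom t) hxy).symm⟩
      exact ⟨⟨(t, c), hc.symm⟩, rfl⟩
    · ext t
      exact t.2
  have hepi : Epi (HomologicalComplex.homologyMap f i) := by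
    rw [HomologicalComplex.epi_homologyMap_iff_up_to_refinements f (i - 1) i (i + 1) (by simp)
      (by simp)]
    intro T z hz
    let T' : Submodule A (T × C.X i × Y.X (i - 1)) := LinearMap.eqLocus
        (z.hom ∘ₗ LinearMap.fst _ _ _)
        ((f.f i).hom ∘ₗ LinearMap.fst _ _ _ ∘ₗ LinearMap.snd _ _ _ +
          (Y.d (i - 1) i).hom ∘ₗ LinearMap.snd _ _ _ ∘ₗ LinearMap.snd _ _ _) ⊓
      (cocycles C i).comap (LinearMap.fst _ _ _ ∘ₗ LinearMap.snd _ _ _)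
    refine ⟨ModuleCat.of A T', ModuleCat.ofHom (LinearMap.fst _ _ _ ∘ₗ T'.subtype), ?_,
      ModuleCat.ofHom ((LinearMap.fst _ _ _ ∘ₗ LinearMap.snd _ _ _) ∘ₗ T'.subtype), ?_,
      ModuleCat.ofHom ((LinearMap.snd _ _ _ ∘ₗ LinearMap.snd _ _ _) ∘ₗ T'.subtype), ?_⟩
    · rw [ModuleCat.epi_iff_surjective]
      intro t
      obtain ⟨c, hc, y, hy⟩ := hsurj i (z.hom t)
        (LinearMap.mem_ker.2 (congrArg (fun φ => φ.hom t) hz))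
      refine ⟨⟨(t, c, -y), ?_, hc⟩, rfl⟩
      change z.hom t = (f.f i).hom c + (Y.d (i - 1) i).hom (-y)
      rw [map_neg, hy]
      abel
    · ext t
      exact t.2.2
    · ext t
      exact t.2.1
  exact isIso_of_mono_of_epi _

end

/-- The sequence indexed by `ℤ` that is `z` above `b`, and is continued downwards by `step`. -/
noncomputable def descendingSequence {St : ℤ → Type*} {b : ℤ} (z : ∀ i, b < i → St i)
    (step : ∀ i, St (i + 1) → St i) (i : ℤ) : St i :=
  if h : b < i then z i h else step i (descendingSequence z step (i + 1))
termination_by (b + 1 - i).toNat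

theorem exists_descending_sequence {St : ℤ → Type*} (R : ∀ i, St i → St (i + 1) → Prop) (b : ℤ)
    (z : ∀ i, b < i → St i) (hz : ∀ i (h : b < i), R i (z i h) (z (i + 1) (by lia)))
    (hstep : ∀ i t, ∃ s, R i s t) :
    ∃ s : ∀ i, St i, (∀ i (h : b < i), s i = z i h) ∧ ∀ i, R i (s i) (s (i + 1)) := by
  choose step hstep using hstep
  have hs (i : ℤ) (h : b < i) : descendingSequence z step i = z i h := by
    rw [descendingSequence, dif_pos h]
  refine ⟨descendingSequence z step, hs, fun i => ?_⟩
  by_cases h : b < i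
  · rw [hs i h, hs (i + 1) (by lia)]
    exact hz i h
  · rw [descendingSequence, dif_neg h]
    exact hstep _ _

/-- The degree `i` part of a resolution `C → Y` by objects satisfying `Q`: a module `obj` that maps
to `Y.X i`, and the submodule `ker` of the elements that will be the `i`-cocycles of `C`. These have
to map onto the cohomology of `Y`. -/
structure ResolutionStage (Q : ObjectProperty (ModuleCat.{u} A))
    (Y : CochainComplex (ModuleCat.{u} A) ℤ) (i : ℤ) where
  obj : ModuleCat.{u} A
  prop : Q obj
  ker : Submodule A obj
  map : obj →ₗ[A] Y.X i
  map_mem : ∀ x ∈ ker, map x ∈ cocycles Y i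
  exists_map_sub_mem : ∀ z ∈ cocycles Y i, ∃ x ∈ ker, map x - z ∈ coboundaries Y i

/-- The map `d` can serve as the differential from degree `i` to degree `i + 1` of the resolution:
its kernel is the prescribed one, its image consists of the prescribed cocycles that become
coboundaries in `Y`, and it is compatible with the maps to `Y`. -/
def ResolutionStage.IsDifferential {Q : ObjectProperty (ModuleCat.{u} A)}
    {Y : CochainComplex (ModuleCat.{u} A) ℤ} {i : ℤ} (s : ResolutionStage Q Y i)
    (t : ResolutionStage Q Y (i + 1)) (d : s.obj →ₗ[A] t.obj) : Prop :=
  (∀ x, d x = 0 ↔ x ∈ s.ker) ∧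
    (∀ y, (∃ x, d x = y) ↔ y ∈ t.ker ∧ t.map y ∈ coboundaries Y (i + 1)) ∧
      ∀ x, (Y.d i (i + 1)).hom (s.map x) = t.map (d x)

/-- The condition that allows resolutions of `Y` by objects satisfying `Q` to be continued
downwards: submodules of `Y.X i × P` whose intersection with `Y.X i` consists of the cocycles are
covered by objects satisfying `Q`, up to coboundaries. -/
def HasCovers (Q : ObjectProperty (ModuleCat.{u} A))
    (Y : CochainComplex (ModuleCat.{u} A) ℤ) : Prop :=
  ∀ (i : ℤ) (P : ModuleCat.{u} A), Q P → ∀ W : Submodule A (Y.X i × P),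
    (∀ y, (y, 0) ∈ W ↔ y ∈ cocycles Y i) →
      ∃ (P' : ModuleCat.{u} A) (_ : Q P') (g : P' →ₗ[A] Y.X i × P), (∀ x, g x ∈ W) ∧
        ∀ w ∈ W, ∃ x, (g x).2 = w.2 ∧ (g x).1 - w.1 ∈ coboundaries Y i

/-- The next stage covers the fibre product `W` of `Y.X i` and the prescribed cocycles of degree
`i + 1`. -/
theorem ResolutionStage.exists_isDifferential {Q : ObjectProperty (ModuleCat.{u} A)}
    {Y : CochainComplex (ModuleCat.{u} A) ℤ} (hY : HasCovers Q Y) {i : ℤ}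
    (t : ResolutionStage Q Y (i + 1)) :
    ∃ (s : ResolutionStage Q Y i) (d : s.obj →ₗ[A] t.obj), s.IsDifferential t d := by
  let W : Submodule A (Y.X i × t.obj) :=
    LinearMap.eqLocus ((Y.d i (i + 1)).hom ∘ₗ LinearMap.fst _ _ _)
      (t.map ∘ₗ LinearMap.snd _ _ _) ⊓ t.ker.comap (LinearMap.snd _ _ _)
  have hW (w : Y.X i × t.obj) :
      w ∈ W ↔ (Y.d i (i + 1)).hom w.1 = t.map w.2 ∧ w.2 ∈ t.ker := Iff.rfl
  have hW0 (y : Y.X i) : (y, 0) ∈ W ↔ y ∈ cocycles Y i := by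
    simp [hW]
  obtain ⟨P, hP, g, hg, hg'⟩ := hY i t.obj t.prop W hW0
  refine ⟨⟨P, hP, LinearMap.ker (LinearMap.snd _ _ _ ∘ₗ g), LinearMap.fst _ _ _ ∘ₗ g,
    fun x hx => ?_, fun z hz => ?_⟩, LinearMap.snd _ _ _ ∘ₗ g, fun x => Iff.rfl, fun y => ?_,
    fun x => (hg x).1⟩
  · have hx : (g x).2 = 0 := hx
    rw [← hW0]
    have := hg x
    rwa [← hx]
  · obtain ⟨x, hx, hx'⟩ := hg' (z, 0) ((hW0 z).2 hz)
    exact ⟨x, hx, hx'⟩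
  · rw [mem_coboundaries_succ]
    constructor
    · rintro ⟨x, rfl⟩
      exact ⟨(hg x).2, (g x).1, (hg x).1⟩
    · rintro ⟨hy, x, hx⟩
      obtain ⟨p, hp, -⟩ := hg' (x, y) ⟨hx, hy⟩
      exact ⟨p, hp⟩

theorem exists_resolution {Q : ObjectProperty (ModuleCat.{u} A)}
    (hQ : Q (ModuleCat.of A PUnit)) {Y : CochainComplex (ModuleCat.{u} A) ℤ}
    (hY : HasCovers Q Y) (b : ℤ) (hb : ∀ i, b < i → Y.ExactAt i) :
    ∃ (C : CochainComplex (ModuleCat.{u} A) ℤ) (f : C ⟶ Y), QuasiIso f ∧ (∀ i, Q (C.X i)) ∧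
      C.IsStrictlyLE b := by
  have hex : ∃ s : ∀ i, ResolutionStage Q Y i, (∀ i, b < i → Subsingleton (s i).obj) ∧
      ∀ i, ∃ d : (s i).obj →ₗ[A] (s (i + 1)).obj, (s i).IsDifferential (s (i + 1)) d := by
    let z (i : ℤ) (hi : b < i) : ResolutionStage Q Y i :=
      ⟨ModuleCat.of A PUnit, hQ, ⊤, 0, fun _ _ => zero_mem _, fun z hz => ⟨0, trivial, by
        simpa using (exactAt_iff_cocycles_le Y i).1 (hb i hi) hz⟩⟩
    obtain ⟨s, hs, hR⟩ := exists_descending_sequence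
      (fun i (s : ResolutionStage Q Y i) t => ∃ d : s.obj →ₗ[A] t.obj, s.IsDifferential t d) b z
      (fun i hi => ⟨0, fun _ => ⟨fun _ => trivial, fun _ => rfl⟩,
        fun y => ⟨fun _ => ⟨trivial, zero_mem _⟩, fun _ => ⟨0, rfl⟩⟩,
        fun x => (map_zero _).trans (map_zero _).symm⟩)
      (fun i t => ResolutionStage.exists_isDifferential hY t)
    refine ⟨s, fun i hi => ?_, hR⟩
    rw [hs i hi]
    exact inferInstanceAs (Subsingleton PUnit)
  obtain ⟨s, hs, hd⟩ := hex
  choose d hd using hd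
  let C : CochainComplex (ModuleCat.{u} A) ℤ := CochainComplex.of (fun i => (s i).obj)
    (fun i => ModuleCat.ofHom (d i)) fun i => by
      ext x
      exact ((hd (i + 1)).1 _).2 (((hd i).2.1 _).1 ⟨x, rfl⟩).1
  have hCd (i : ℤ) : C.d i (i + 1) = ModuleCat.ofHom (d i) :=
    CochainComplex.of_d (fun i => (s i).obj) (fun i => ModuleCat.ofHom (d i)) i
  let f : C ⟶ Y :=
    { f := fun i => ModuleCat.ofHom (s i).map
      comm' := by
        rintro i _ rfl
        rw [hCd]
        ext x
        exact (hd i).2.2 x }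
  have hZ (i : ℤ) (c : C.X i) : c ∈ cocycles C i ↔ c ∈ (s i).ker := by
    rw [LinearMap.mem_ker, hCd]
    exact (hd i).1 c
  refine ⟨C, f, quasiIso_of_cocycles f (fun i z hz => ?_) fun i c hc hc' => ?_,
    fun i => (s i).prop, ?_⟩
  · obtain ⟨c, hc, hc'⟩ := (s i).exists_map_sub_mem z hz
    exact ⟨c, (hZ i c).2 hc, hc'⟩
  · obtain ⟨i, rfl⟩ : ∃ j, i = j + 1 := ⟨i - 1, by lia⟩
    obtain ⟨x, hx⟩ := ((hd i).2.1 c).2 ⟨(hZ _ c).1 hc, hc'⟩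
    rw [mem_coboundaries_succ, hCd]
    exact ⟨x, hx⟩
  · rw [CochainComplex.isStrictlyLE_iff]
    intro i hi
    have := hs i hi
    exact ModuleCat.isZero_of_subsingleton (C.X i)

theorem hasCovers_projective (Y : CochainComplex (ModuleCat.{u} A) ℤ) :
    HasCovers (fun P => Projective P) Y := by
  intro i P _ W _
  let π : Projective.over (ModuleCat.of A W) ⟶ ModuleCat.of A W := Projective.π _
  refine ⟨Projective.over (ModuleCat.of A W), inferInstance, W.subtype ∘ₗ π.hom,
    fun x => (π.hom x).2, fun w hw => ?_⟩
  obtain ⟨x, hx⟩ := (ModuleCat.epi_iff_surjective π).1 inferInstance ⟨w, hw⟩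
  have hx : W.subtype (π.hom x) = w := congrArg Subtype.val hx
  refine ⟨x, congrArg Prod.snd hx, ?_⟩
  have h : ((W.subtype ∘ₗ π.hom) x).1 - w.1 = 0 := sub_eq_zero.2 (congrArg Prod.fst hx)
  rw [h]
  exact zero_mem _

end ModuleComplex

/-! ### Finite resolutions of injective complexes -/

namespace GroupModule
open GoodGroup ModuleComplex

variable {k : Type u} [Field k] {Υ : Type u} [Group Υ]

section
variable {M₁ M₂ M₃ : Type u} [AddCommGroup M₁] [AddCommGroup M₂] [AddCommGroup M₃]
  [Module (MonoidAlgebra k Υ) M₁] [Module (MonoidAlgebra k Υ) M₂] [Module (MonoidAlgebra k Υ) M₃]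
  {i : M₁ →ₗ[MonoidAlgebra k Υ] M₂} {p : M₂ →ₗ[MonoidAlgebra k Υ] M₃}

theorem isEffaceable_quotient (h₁ : IsEffaceable (action k Υ M₁))
    (h₂ : IsEffaceable (action k Υ M₂)) (hi : Function.Injective i)
    (hip : Function.Exact i p) (hp : Function.Surjective p) : IsEffaceable (action k Υ M₃) :=
  h₁.of_quotient h₂ (i := i.toAddMonoidHom) (p := p.toAddMonoidHom) (fun _ _ => map_smul i _ _)
    (fun _ _ => map_smul p _ _) hi hip hp

theorem isEffaceable_extension (h₁ : IsEffaceable (action k Υ M₁))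
    (h₃ : IsEffaceable (action k Υ M₃)) (hi : Function.Injective i)
    (hip : Function.Exact i p) (hp : Function.Surjective p) : IsEffaceable (action k Υ M₂) :=
  h₁.of_extension h₃ (i := i.toAddMonoidHom) (p := p.toAddMonoidHom) (fun _ _ => map_smul i _ _)
    (fun _ _ => map_smul p _ _) hi hip hp

theorem eventually_differential_zero_iff (c : (Fin 0 → Υ) → M₁) :
    (∀ᶠ g in finiteIndexFilter Υ 1, differential (action k Υ M₁) 0 c g = 0) ↔
      IsSmooth k (Υ := Υ) (c 1) := by
  have h (g : Fin 1 → Υ) : differential (action k Υ M₁) 0 c g =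
      MonoidAlgebra.of k Υ (g 0) • c 1 - c 1 := by
    simp only [differential, AddMonoidHom.coe_mk, ZeroHom.coe_mk, action_apply,
      Subsingleton.elim _ (1 : Fin 0 → Υ)]
    simp [sub_eq_add_neg]
  simp only [h, sub_eq_zero, IsSmooth, eventually_finiteIndexFilter]
  refine exists_congr fun N => and_congr_right fun _ => ⟨fun h g hg => ?_, fun h g hg => h _ (hg 0)⟩
  exact h (fun _ => g) fun _ => hg

theorem isSmooth_of_finite [Finite M₁] (m : M₁) : IsSmooth k (Υ := Υ) m := by
  have : Finite (AddMonoid.End M₁) :=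
    Finite.of_injective (fun φ => (φ : M₁ → M₁)) DFunLike.coe_injective
  refine ⟨(MonoidHom.toHomUnits (action k Υ M₁)).ker, inferInstance, fun g hg => ?_⟩
  exact congrArg (fun φ : (AddMonoid.End M₁)ˣ => (φ : AddMonoid.End M₁) m) hg

/-- The case of degree zero of the lifting of cocycles along `M₂ → M₃`. -/
theorem exists_isSmooth_lift [Finite M₃] (h₁ : IsEffaceable (action k Υ M₁))
    (hi : Function.Injective i) (hip : Function.Exact i p) (hp : Function.Surjective p) (m : M₃) :
    ∃ m' : M₂, IsSmooth k (Υ := Υ) m' ∧ p m' = m := by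
  obtain ⟨b, hb, hb'⟩ := h₁.exists_lift (i := i.toAddMonoidHom) (p := p.toAddMonoidHom)
    (β := action k Υ M₂) (γ := action k Υ M₃) (fun _ _ => map_smul i _ _)
    (fun _ _ => map_smul p _ _) hi hip hp (fun _ : Fin 0 → Υ => m)
    ((eventually_differential_zero_iff _).2 (isSmooth_of_finite m))
  exact ⟨b 1, (eventually_differential_zero_iff b).1 hb', hb 1⟩

end

/-- All cohomology groups of the complex `Y` are finite. -/
def HasFiniteCohomology {A : Type u} [Ring A] (Y : CochainComplex (ModuleCat.{u} A) ℤ) : Prop :=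
  ∀ i, Finite (cocycles Y i ⧸ (coboundaries Y i).submoduleOf (cocycles Y i))

/-- By induction on the degree, the coboundaries `Bⁱ` and the cocycles `Zⁱ` of a bounded below
complex of injective modules with finite cohomology are effaceable. -/
theorem isEffaceable_coboundaries (H : Subgroup Υ) [H.Normal] [Finite H]
    (hG : IsGood (Υ ⧸ H)) (I : CochainComplex (ModuleCat.{u} (MonoidAlgebra k Υ)) ℤ) (a : ℤ)
    [I.IsStrictlyGE a] [∀ i, Injective (I.X i)] (hI : HasFiniteCohomology I) (i : ℤ) :
    IsEffaceable (action k Υ (coboundaries I i)) := by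
  have hZ (i : ℤ) (h : IsEffaceable (action k Υ (coboundaries I i))) :
      IsEffaceable (action k Υ (cocycles I i)) := by
    have := hI i
    refine isEffaceable_extension (i := Submodule.inclusion (coboundaries_le_cocycles I i))
      (p := ((coboundaries I i).submoduleOf (cocycles I i)).mkQ) h (hG.isEffaceable H _)
      (Submodule.inclusion_injective _) ?_ (Submodule.mkQ_surjective _)
    intro z
    rw [Submodule.mkQ_apply, Submodule.Quotient.mk_eq_zero]
    exact ⟨fun hz => ⟨⟨z, hz⟩, rfl⟩, by rintro ⟨b, rfl⟩; exact b.2⟩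
  have hB (i : ℤ) (h : IsEffaceable (action k Υ (cocycles I i))) :
      IsEffaceable (action k Υ (coboundaries I (i + 1))) := by
    refine isEffaceable_quotient (i := (cocycles I i).subtype)
      (p := (I.d i (i + 1)).hom.codRestrict (coboundaries I (i + 1)) (d_mem_coboundaries I _ _)) h
      (isEffaceable_of_injective (I.X i)) Subtype.val_injective ?_ ?_
    · intro x
      rw [Subtype.ext_iff]
      exact ⟨fun hx => ⟨⟨x, hx⟩, rfl⟩, by rintro ⟨z, rfl⟩; exact z.2⟩
    · rintro ⟨y, hy⟩
      obtain ⟨x, hx⟩ := (mem_coboundaries_succ I).1 hy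
      exact ⟨x, Subtype.ext hx⟩
  have h0 (i : ℤ) (hi : i < a) : IsEffaceable (action k Υ (coboundaries I i)) := by
    have := ModuleCat.subsingleton_of_isZero (I.isZero_of_isStrictlyGE a i hi)
    exact hG.isEffaceable H _
  rcases lt_or_ge i (a - 1) with hi | hi
  · exact h0 i (by lia)
  · induction i, hi using Int.leInduction with
    | base => exact h0 _ (by lia)
    | succ i hi ih => exact hB i (hZ i ih)

/-- The finite `kΥ`-modules that are projective over `kH`. -/
def finiteProjective (k : Type u) [Field k] {Υ : Type u} [Group Υ] (H : Subgroup Υ) :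
    ObjectProperty (ModuleCat.{u} (MonoidAlgebra k Υ)) := fun P =>
  Finite P ∧ Module.Projective (MonoidAlgebra k H)
    ((ModuleCat.restrictScalars (groupAlgebraInclusion k H)).obj P)

/-- A module `W` to be covered is finite modulo coboundaries, and the elements of the finite
quotient have smooth lifts because the coboundaries are effaceable. -/
theorem hasCovers_finiteProjective [Finite k] (H : Subgroup Υ) [H.Normal] [Finite H]
    (hG : IsGood (Υ ⧸ H)) (I : CochainComplex (ModuleCat.{u} (MonoidAlgebra k Υ)) ℤ) (a : ℤ)
    [I.IsStrictlyGE a] [∀ i, Injective (I.X i)] (hI : HasFiniteCohomology I) :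
    HasCovers (finiteProjective k H) I := by
  rintro i P ⟨hP, -⟩ W hW
  let j : coboundaries I i →ₗ[MonoidAlgebra k Υ] W :=
    (LinearMap.inl _ _ _ ∘ₗ (coboundaries I i).subtype).codRestrict W
      fun y => (hW y).2 (coboundaries_le_cocycles I i y.2)
  have hj : Function.Injective j := fun y y' h =>
    Subtype.ext (congrArg (fun w : W => (w : I.X i × P).1) h)
  have hrange (w : W) : w ∈ LinearMap.range j ↔
      (w : I.X i × P).1 ∈ coboundaries I i ∧ (w : I.X i × P).2 = 0 := by
    constructor
    · rintro ⟨y, rfl⟩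
      exact ⟨y.2, rfl⟩
    · rintro ⟨h, h'⟩
      exact ⟨⟨_, h⟩, Subtype.ext (Prod.ext rfl h'.symm)⟩
  -- `W / Bⁱ` is an extension of a submodule of the finite module `P` by the cohomology in degree
  -- `i`.
  have hfin : Finite (W ⧸ LinearMap.range j) := by
    have := hI i
    have hex (p : P) : ∃ w : W, (∃ w' : W, (w' : I.X i × P).2 = p) → (w : I.X i × P).2 = p := by
      by_cases h : ∃ w' : W, (w' : I.X i × P).2 = p
      · exact ⟨h.choose, fun _ => h.choose_spec⟩
      · exact ⟨0, fun h' => absurd h' h⟩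
    choose s hs using hex
    let t (z : cocycles I i) : W := ⟨(z, 0), (hW z).2 z.2⟩
    refine Finite.of_surjective
      (fun q : P × (cocycles I i ⧸ (coboundaries I i).submoduleOf (cocycles I i)) =>
        (Submodule.Quotient.mk (s q.1 + t (Quotient.out q.2)) : W ⧸ LinearMap.range j)) fun w => ?_
    obtain ⟨w, rfl⟩ := Submodule.Quotient.mk_surjective _ w
    have hsw := hs (w : I.X i × P).2 ⟨w, rfl⟩
    have hy : (w : I.X i × P).1 - (s (w : I.X i × P).2 : I.X i × P).1 ∈ cocycles I i := by
      rw [← hW]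
      have := (w - s (w : I.X i × P).2).2
      rwa [show ((w - s (w : I.X i × P).2 : W) : I.X i × P) = (_, 0) from
        Prod.ext rfl (by simp [hsw])] at this
    refine ⟨((w : I.X i × P).2, Submodule.Quotient.mk ⟨_, hy⟩), ?_⟩
    rw [Submodule.Quotient.eq, hrange]
    have hout := (Submodule.Quotient.eq _).1 (Quotient.out_eq (Submodule.Quotient.mk ⟨_, hy⟩ :
      cocycles I i ⧸ (coboundaries I i).submoduleOf (cocycles I i)))
    refine ⟨?_, ?_⟩
    · convert Submodule.mem_comap.1 hout using 1
      simp [t]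
      abel
    · simp [t, hsw]
  choose l hl hl' using exists_isSmooth_lift (k := k) (Υ := Υ) (i := j)
    (p := (LinearMap.range j).mkQ) (isEffaceable_coboundaries H hG I a hI i) hj
    (LinearMap.exact_map_mkQ_range j) (Submodule.mkQ_surjective _)
  obtain ⟨P', hP', hP'', L, hL⟩ := exists_finite_cover H hG (Set.range l) (Set.finite_range l)
    (by rintro _ ⟨q, rfl⟩; exact hl q)
  refine ⟨P', ⟨hP', hP''⟩, W.subtype ∘ₗ L, fun x => (L x).2, fun w hw => ?_⟩
  obtain ⟨x, hx⟩ := hL ⟨Submodule.Quotient.mk ⟨w, hw⟩, rfl⟩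
  have h1 := (Submodule.Quotient.eq _).1 (hl' (Submodule.Quotient.mk ⟨w, hw⟩))
  rw [← hx, hrange] at h1
  exact ⟨x, sub_eq_zero.1 h1.2, h1.1⟩

end GroupModule

/-! ### The relative homotopy category and the derived category -/

namespace RelHo
open ModuleComplex DerivedCategory

theorem inducesEquivalence_of_bijective {C D : Type*} [Category* C] [Category* D] (F : C ⥤ D)
    {P : ObjectProperty C} {Q : ObjectProperty D} (hPQ : ∀ X, P X → Q (F.obj X))
    (hF : ∀ X Y, P X → P Y → Function.Bijective (F.map : (X ⟶ Y) → (F.obj X ⟶ F.obj Y)))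
    (hQ : ∀ Y, Q Y → ∃ X, P X ∧ Nonempty (F.obj X ≅ Y)) : InducesEquivalence F P Q := by
  refine ⟨fun X => hPQ _ X.property, ?_⟩
  have hfaithful : (Q.lift (P.ι ⋙ F) fun X => hPQ _ X.property).Faithful := ⟨fun {X Y} f g h =>
    P.hom_ext ((hF X.obj Y.obj X.property Y.property).1 (congrArg (fun φ => φ.hom) h))⟩
  have hfull : (Q.lift (P.ι ⋙ F) fun X => hPQ _ X.property).Full := ⟨fun {X Y} g => by
    obtain ⟨f, hf⟩ := (hF X.obj Y.obj X.property Y.property).2 g.hom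
    exact ⟨P.homMk f, Q.hom_ext hf⟩⟩
  have hess : (Q.lift (P.ι ⋙ F) fun X => hPQ _ X.property).EssSurj := ⟨fun Y => by
    obtain ⟨X, hX, ⟨e⟩⟩ := hQ Y.obj Y.property
    exact ⟨⟨X, hX⟩, ⟨Q.isoMk e⟩⟩⟩
  exact { }

section
variable {A : Type u} [Ring A]

theorem IsBoundedProj.exists_isStrictlyLE {K : CochainComplex (ModuleCat.{u} A) ℤ}
    (hK : IsBoundedProj K) : ∃ b, K.IsStrictlyLE b := by
  obtain ⟨⟨a, b, h⟩, -⟩ := hK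
  exact ⟨b, (CochainComplex.isStrictlyLE_iff K b).2 fun i hi => h i (.inr hi)⟩

theorem IsBoundedProj.isKProjective {K : CochainComplex (ModuleCat.{u} A) ℤ}
    (hK : IsBoundedProj K) : K.IsKProjective := by
  obtain ⟨b, hb⟩ := hK.exists_isStrictlyLE
  have (i : ℤ) : Projective (K.X i) := (IsProjective.iff_projective (K.X i)).1 (hK.2 i).2
  exact K.isKProjective_of_projective b

theorem nonempty_iso_of_isKProjective [HasDerivedCategory.{w₂} (ModuleCat.{u} A)]
    {K L : CochainComplex (ModuleCat.{u} A) ℤ} [K.IsKProjective] [L.IsKProjective]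
    (e : Q.obj K ≅ Q.obj L) :
    Nonempty ((HomotopyCategory.quotient _ (ComplexShape.up ℤ)).obj K ≅
      (HomotopyCategory.quotient _ _).obj L) := by
  let e' := (quotientCompQhIso _).app K ≪≫ e ≪≫ ((quotientCompQhIso _).app L).symm
  obtain ⟨f, hf⟩ := (CochainComplex.IsKProjective.Qh_map_bijective K
    ((HomotopyCategory.quotient _ _).obj L)).2 e'.hom
  obtain ⟨g, hg⟩ := (CochainComplex.IsKProjective.Qh_map_bijective L
    ((HomotopyCategory.quotient _ _).obj K)).2 e'.inv
  refine ⟨⟨f, g, (CochainComplex.IsKProjective.Qh_map_bijective K _).1 ?_,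
    (CochainComplex.IsKProjective.Qh_map_bijective L _).1 ?_⟩⟩
  · rw [Functor.map_comp, hf, hg, Iso.hom_inv_id, CategoryTheory.Functor.map_id]
  · rw [Functor.map_comp, hf, hg, Iso.inv_hom_id, CategoryTheory.Functor.map_id]

theorem nonempty_homology_iso [HasDerivedCategory.{w₂} (ModuleCat.{u} A)]
    {K L : CochainComplex (ModuleCat.{u} A) ℤ} (e : Q.obj K ≅ Q.obj L) (i : ℤ) :
    Nonempty (K.homology i ≅ L.homology i) :=
  ⟨((homologyFunctorFactors _ i).app K).symm ≪≫ (homologyFunctor _ i).mapIso e ≪≫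
    (homologyFunctorFactors _ i).app L⟩

end

variable {A B : Type u} [Ring A] [Ring B] (φ : A →+* B)

/-- The restriction of complexes along `φ : A → B`. -/
noncomputable abbrev resComplex :
    CochainComplex (ModuleCat.{u} B) ℤ ⥤ CochainComplex (ModuleCat.{u} A) ℤ :=
  (ModuleCat.restrictScalars.{u} φ).mapHomologicalComplex (ComplexShape.up ℤ)

theorem exactAt_resComplex_iff (X : CochainComplex (ModuleCat.{u} B) ℤ) (i : ℤ) :
    ((resComplex φ).obj X).ExactAt i ↔ X.ExactAt i := by
  rw [HomologicalComplex.exactAt_iff, HomologicalComplex.exactAt_iff]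
  exact ShortComplex.exact_map_iff_of_faithful (X.sc i) (ModuleCat.restrictScalars.{u} φ)

/-- A quasi-isomorphism of complexes of `B`-modules whose restrictions are K-projective becomes
invertible in the relative homotopy category, since its restriction is a homotopy equivalence. -/
theorem isIso_toHoRel_map {X Y : CochainComplex (ModuleCat.{u} B) ℤ} (f : X ⟶ Y) [QuasiIso f]
    [((resComplex φ).obj X).IsKProjective] [((resComplex φ).obj Y).IsKProjective] :
    IsIso ((toHoRel φ).map ((HomotopyCategory.quotient _ _).map f)) := by
  have h : HomologicalComplex.homotopyEquivalences _ _ ((resComplex φ).map f) :=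
    (CochainComplex.IsKProjective.quasiIso_iff _).1 inferInstance
  rw [← HomotopyCategory.inverseImage_quotient_isomorphisms,
    MorphismProperty.inverseImage_iff, MorphismProperty.isomorphisms.iff] at h
  refine (resKernel φ).trW.Q_inverts _ ?_
  obtain ⟨Z, g, h', hT⟩ := Pretriangulated.distinguished_cocone_triangle
    ((HomotopyCategory.quotient _ (ComplexShape.up ℤ)).map f)
  exact ⟨Z, g, h', hT, (Pretriangulated.Triangle.isZero₃_iff_isIso₁ _
    ((resHo φ).map_distinguished _ hT)).2 h⟩

theorem exists_quotient_obj (X : HoRel φ) : ∃ C : CochainComplex (ModuleCat.{u} B) ℤ,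
    X = (toHoRel φ).obj ((HomotopyCategory.quotient _ _).obj C) := by
  obtain ⟨X, rfl⟩ := (Localization.Construction.objEquiv _).surjective X
  obtain ⟨C, rfl⟩ := HomotopyCategory.quotient_obj_surjective X
  exact ⟨C, rfl⟩

theorem resBoundedProj_le : resBoundedProj φ ≤ resHoBoundedProj φ := by
  rintro _ ⟨C, hC, rfl⟩
  exact ⟨_, hC, ⟨Iso.refl _⟩⟩

section
variable [HasDerivedCategory.{w₂} (ModuleCat.{u} A)]
  [(ModuleCat.restrictScalars.{u} φ).PreservesProjectiveObjects]

/-- A complex of `B`-modules whose restriction is perfect has a projective resolution, which is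
K-projective over `B` and over `A`. -/
theorem exists_projective_resolution {X : CochainComplex (ModuleCat.{u} B) ℤ}
    {K : CochainComplex (ModuleCat.{u} A) ℤ} (hK : IsBoundedProj K)
    (e : Q.obj ((resComplex φ).obj X) ≅ Q.obj K) :
    ∃ (P : CochainComplex (ModuleCat.{u} B) ℤ) (f : P ⟶ X), QuasiIso f ∧ P.IsKProjective ∧
      ((resComplex φ).obj P).IsKProjective := by
  obtain ⟨b, hb⟩ := hK.exists_isStrictlyLE
  obtain ⟨P, f, hf, hP, hb'⟩ := exists_resolution (Q := fun P => Projective P)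
    ((IsProjective.iff_projective PUnit).1 inferInstance)
    (hasCovers_projective X) b fun i hi => by
      rw [← exactAt_resComplex_iff φ, HomologicalComplex.exactAt_iff_isZero_homology]
      exact IsZero.of_iso (((HomologicalComplex.exactAt_iff_isZero_homology _ _).1
        (K.exactAt_of_isLE b i hi))) (nonempty_homology_iso e i).some
  have (i : ℤ) : Projective (P.X i) := hP i
  have (i : ℤ) : Projective (((resComplex φ).obj P).X i) :=
    (ModuleCat.restrictScalars.{u} φ).projective_obj (P.X i)
  have : ((resComplex φ).obj P).IsStrictlyLE b := (CochainComplex.isStrictlyLE_iff _ b).2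
    fun i hi => (ModuleCat.restrictScalars.{u} φ).map_isZero (P.isZero_of_isStrictlyLE b i hi)
  exact ⟨P, f, hf, P.isKProjective_of_projective b,
    CochainComplex.isKProjective_of_projective _ b⟩

/-- In the relative homotopy category, a complex whose restriction is homotopy equivalent to a
bounded complex of finitely generated projectives is isomorphic to its projective resolution. -/
theorem exists_isKProjective_of_resHoBoundedProj {X : HoRel φ} (hX : resHoBoundedProj φ X) :
    ∃ P : CochainComplex (ModuleCat.{u} B) ℤ, P.IsKProjective ∧
      Nonempty ((toHoRel φ).obj ((HomotopyCategory.quotient _ _).obj P) ≅ X) := by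
  obtain ⟨K, hK, ⟨e⟩⟩ := hX
  obtain ⟨C, rfl⟩ := exists_quotient_obj φ X
  obtain ⟨P, f, hf, hP, hP'⟩ := exists_projective_resolution φ (X := C) hK
    (((quotientCompQhIso _).app _).symm ≪≫ Qh.mapIso e ≪≫ (quotientCompQhIso _).app K)
  have := hK.isKProjective
  have : ((resComplex φ).obj C).IsKProjective :=
    (HomotopyCategory.homotopyEquivOfIso e.symm).isKProjective
  have := isIso_toHoRel_map φ f
  exact ⟨P, hP, ⟨asIso ((toHoRel φ).map ((HomotopyCategory.quotient _ _).map f))⟩⟩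

end

section
variable [HasDerivedCategory.{w₁} (ModuleCat.{u} B)]

/-- The image in `D(B)` of the object of `Ho(B, A)` given by a complex. -/
noncomputable def hoRelToDerivedIso (X : CochainComplex (ModuleCat.{u} B) ℤ) :
    (hoRelToDerived φ).obj ((toHoRel φ).obj ((HomotopyCategory.quotient _ _).obj X)) ≅ Q.obj X :=
  (quotientCompQhIso _).app X

theorem hoRelToDerived_map_toHoRel_map
    {X Y : HomotopyCategory (ModuleCat.{u} B) (ComplexShape.up ℤ)} (f : X ⟶ Y) :
    (hoRelToDerived φ).map ((toHoRel φ).map f) = Qh.map f := by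
  have h := Functor.congr_hom (Localization.Construction.fac Qh fun _ _ f hf =>
    Localization.inverts Qh (HomotopyCategory.subcategoryAcyclic (ModuleCat.{u} B)).trW f
      (ObjectProperty.trW_monotone (resKernel_le_acyclic φ) f hf)) f
  exact h.trans ((Category.id_comp _).trans (Category.comp_id _))

variable [HasDerivedCategory.{w₂} (ModuleCat.{u} A)]

/-- The isomorphism between the restriction of an object of `D(B)` and the object given by the
restricted complex. -/
noncomputable def mapDerivedCategoryIso {D : DerivedCategory (ModuleCat.{u} B)}
    {X : CochainComplex (ModuleCat.{u} B) ℤ} (e : D ≅ Q.obj X) :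
    (ModuleCat.restrictScalars.{u} φ).mapDerivedCategory.obj D ≅ Q.obj ((resComplex φ).obj X) :=
  (ModuleCat.restrictScalars.{u} φ).mapDerivedCategory.mapIso e ≪≫
    (ModuleCat.restrictScalars.{u} φ).mapDerivedCategoryFactors.app X

theorem resHoBoundedProj_le : ∀ X : HoRel φ, resHoBoundedProj φ X →
    resPerfect.{u, w₁, w₂} φ ((hoRelToDerived φ).obj X) := by
  rintro X ⟨K, hK, ⟨e⟩⟩
  obtain ⟨C, rfl⟩ := exists_quotient_obj φ X
  exact ⟨K, hK, ⟨mapDerivedCategoryIso φ (hoRelToDerivedIso φ C) ≪≫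
    ((quotientCompQhIso _).app _).symm ≪≫ Qh.mapIso e ≪≫ (quotientCompQhIso _).app K⟩⟩

variable [(ModuleCat.restrictScalars.{u} φ).PreservesProjectiveObjects]

/-- Replacing `X` by a K-projective complex `P`, this holds because `P` is left orthogonal to the
acyclic complexes, hence to the complexes in `resKernel φ`, so that the morphisms out of `P` are the
same in the homotopy category and in both of its Verdier quotients. -/
theorem hoRelToDerived_map_bijective {X : HoRel φ} (hX : resHoBoundedProj φ X) (Y : HoRel φ) :
    Function.Bijective ((hoRelToDerived φ).map : (X ⟶ Y) → _) := by
  obtain ⟨P, hP, ⟨e⟩⟩ := exists_isKProjective_of_resHoBoundedProj φ hX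
  obtain ⟨C, rfl⟩ := exists_quotient_obj φ Y
  have h₁ : (HomotopyCategory.subcategoryAcyclic (ModuleCat.{u} B)).leftOrthogonal
      ((HomotopyCategory.quotient _ _).obj P) := CochainComplex.IsKProjective.leftOrthogonal P
  have h₂ : (resKernel φ).leftOrthogonal ((HomotopyCategory.quotient _ _).obj P) :=
    fun Z f hZ => h₁ f (resKernel_le_acyclic φ Z hZ)
  have hQ := h₂.map_bijective_of_isTriangulated (toHoRel φ) ((HomotopyCategory.quotient _ _).obj C)
  have hQh := h₁.map_bijective_of_isTriangulated Qh ((HomotopyCategory.quotient _ _).obj C)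
  have h : Function.Bijective ((hoRelToDerived φ).map :
      ((toHoRel φ).obj ((HomotopyCategory.quotient _ _).obj P) ⟶
        (toHoRel φ).obj ((HomotopyCategory.quotient _ _).obj C)) → _) := by
    refine (Function.Bijective.of_comp_iff _ hQ).1 ?_
    refine (congrArg Function.Bijective (funext fun f => ?_)).mp hQh
    exact (hoRelToDerived_map_toHoRel_map φ f).symm
  have h' := (((hoRelToDerived φ).mapIso e).homFromEquiv.bijective.comp h).comp
    e.symm.homFromEquiv.bijective
  refine (congrArg Function.Bijective (funext fun f => ?_)).mp h'
  simp [Iso.homFromEquiv, ← Functor.map_comp]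

theorem inducesEquivalence_resHoBoundedProj :
    InducesEquivalence (hoRelToDerived φ) (resHoBoundedProj φ) (resPerfect.{u, w₁, w₂} φ) := by
  refine inducesEquivalence_of_bijective _ (resHoBoundedProj_le φ)
    (fun X Y hX _ => hoRelToDerived_map_bijective φ hX Y) fun D => ?_
  rintro ⟨K, hK, ⟨e⟩⟩
  let X := Q.objPreimage D
  have eX : D ≅ Q.obj X := (Q.objObjPreimageIso D).symm
  have eK := (mapDerivedCategoryIso φ eX).symm ≪≫ e
  obtain ⟨P, f, hf, hP, hP'⟩ := exists_projective_resolution φ hK eK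
  have := hK.isKProjective
  have : QuasiIso ((resComplex φ).map f) := inferInstance
  have e' := nonempty_iso_of_isKProjective (K := (resComplex φ).obj P)
    (asIso (Q.map ((resComplex φ).map f)) ≪≫ eK)
  refine ⟨(toHoRel φ).obj ((HomotopyCategory.quotient _ _).obj P), ⟨K, hK, e'⟩,
    ⟨hoRelToDerivedIso φ P ≪≫ asIso (Q.map f) ≪≫ eX.symm⟩⟩

theorem inducesEquivalence_resBoundedProj
    (h : ∀ D : DerivedCategory (ModuleCat.{u} B), resPerfect.{u, w₁, w₂} φ D →
      ∃ C : CochainComplex (ModuleCat.{u} B) ℤ,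
        IsBoundedProj ((resComplex φ).obj C) ∧ Nonempty (Q.obj C ≅ D)) :
    InducesEquivalence (hoRelToDerived φ) (resBoundedProj φ) (resPerfect.{u, w₁, w₂} φ) := by
  refine inducesEquivalence_of_bijective _
    (fun X hX => resHoBoundedProj_le φ X (resBoundedProj_le φ X hX))
    (fun X Y hX _ => hoRelToDerived_map_bijective φ (resBoundedProj_le φ X hX) Y) fun D hD => ?_
  obtain ⟨C, hC, ⟨e⟩⟩ := h D hD
  exact ⟨_, ⟨C, hC, rfl⟩, ⟨hoRelToDerivedIso φ C ≪≫ e⟩⟩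

end

/-! ### Truncation of complexes with perfect restriction -/

section

/-- The `B`-modules that are finitely generated projective over `A`. -/
def resFiniteProjective : ObjectProperty (ModuleCat.{u} B) := fun P =>
  Module.Finite A ((ModuleCat.restrictScalars.{u} φ).obj P) ∧
    Module.Projective A ((ModuleCat.restrictScalars.{u} φ).obj P)

variable {φ}

theorem resFiniteProjective.of_retract {P P' : ModuleCat.{u} B} (hP : resFiniteProjective φ P)
    (i : (ModuleCat.restrictScalars.{u} φ).obj P' ⟶ (ModuleCat.restrictScalars.{u} φ).obj P)
    (r : (ModuleCat.restrictScalars.{u} φ).obj P ⟶ (ModuleCat.restrictScalars.{u} φ).obj P')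
    (h : i ≫ r = 𝟙 _) : resFiniteProjective φ P' := by
  obtain ⟨h₁, h₂⟩ := hP
  have h' (x) : r.hom (i.hom x) = x := congrArg (fun ψ => ψ.hom x) h
  exact ⟨Module.Finite.of_surjective r.hom fun x => ⟨_, h' x⟩,
    Module.Projective.of_split i.hom r.hom (LinearMap.ext h')⟩

theorem resFiniteProjective.of_iso {P P' : ModuleCat.{u} B} (hP : resFiniteProjective φ P)
    (e : P' ≅ P) : resFiniteProjective φ P' :=
  hP.of_retract ((ModuleCat.restrictScalars.{u} φ).map e.hom)
    ((ModuleCat.restrictScalars.{u} φ).map e.inv) (by rw [← Functor.map_comp, e.hom_inv_id,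
      CategoryTheory.Functor.map_id])

/-- If the restriction of `C` is homotopy equivalent to a complex that is zero in degree `m`, then
the map from `Cᵐ` modulo coboundaries to `Cᵐ⁺¹` has a retraction over `A`, given by the homotopy. -/
theorem resFiniteProjective_opcycles {C : CochainComplex (ModuleCat.{u} B) ℤ}
    {K : CochainComplex (ModuleCat.{u} A) ℤ} (e : HomotopyEquiv ((resComplex φ).obj C) K) (m : ℤ)
    (hm : IsZero (K.X m)) (hC : resFiniteProjective φ (C.X (m + 1))) :
    resFiniteProjective φ (C.opcycles m) := by
  let F := ModuleCat.restrictScalars.{u} φ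
  let h : F.obj (C.X (m + 1)) ⟶ F.obj (C.X m) := e.homotopyHomInvId.hom (m + 1) m
  let h' : F.obj (C.X m) ⟶ F.obj (C.X (m - 1)) := e.homotopyHomInvId.hom m (m - 1)
  have hh : F.map (C.d m (m + 1)) ≫ h + h' ≫ F.map (C.d (m - 1) m) + 𝟙 (F.obj (C.X m)) = 0 := by
    have := e.homotopyHomInvId.comm m
    rw [dNext_eq _ (show (ComplexShape.up ℤ).Rel m (m + 1) by simp),
      prevD_eq _ (show (ComplexShape.up ℤ).Rel (m - 1) m by simp)] at this
    refine this.symm.trans ?_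
    rw [HomologicalComplex.comp_f, hm.eq_zero_of_tgt (e.hom.f m), zero_comp]
    rfl
  refine hC.of_retract (F.map (C.fromOpcycles m (m + 1))) ((-h) ≫ F.map (C.pOpcycles m)) ?_
  rw [← cancel_epi (F.map (C.pOpcycles m)), ← Functor.map_comp_assoc, C.p_fromOpcycles,
    Category.comp_id]
  have h1 : F.map (C.d m (m + 1)) ≫ (-h) = 𝟙 _ + h' ≫ F.map (C.d (m - 1) m) := by
    rw [Preadditive.comp_neg, neg_eq_iff_add_eq_zero, ← hh]
    abel
  rw [reassoc_of% h1, Preadditive.add_comp, Category.id_comp, Category.assoc, ← Functor.map_comp,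
    C.d_pOpcycles, Functor.map_zero, comp_zero, add_zero]

theorem exists_isBoundedProj_truncGE {C : CochainComplex (ModuleCat.{u} B) ℤ} (b : ℤ)
    [C.IsStrictlyLE b] (hC : ∀ i, resFiniteProjective φ (C.X i))
    {K : CochainComplex (ModuleCat.{u} A) ℤ} (hK : IsBoundedProj K)
    (e : HomotopyEquiv ((resComplex φ).obj C) K) :
    ∃ m, C.IsGE m ∧ IsBoundedProj ((resComplex φ).obj (C.truncGE m)) := by
  obtain ⟨⟨a, b', ha⟩, -⟩ := hK
  have hz (i : ℤ) (hi : i < a) : IsZero (K.X i) := ha i (.inl hi)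
  -- Truncation at `a - 1` rather than at `a`, since the homotopy splits the truncated complex in
  -- its lowest degree only if `K` is zero there.
  refine ⟨a - 1, (CochainComplex.isGE_iff _ _).2 fun i hi => ?_,
    ⟨⟨a - 1, b, fun i hi => ?_⟩, fun i => ?_⟩⟩
  · rw [← exactAt_resComplex_iff φ, HomologicalComplex.exactAt_iff_isZero_homology]
    exact (ShortComplex.isZero_homology_of_isZero_X₂ (K.sc i) (hz i (by lia))).of_iso
      (e.toHomologyIso i)
  · refine (ModuleCat.restrictScalars.{u} φ).map_isZero ?_
    rcases hi with hi | hi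
    · exact (C.truncGE (a - 1)).isZero_of_isStrictlyGE (a - 1) i hi
    · exact (C.truncGE (a - 1)).isZero_of_isStrictlyLE b i hi
  · change resFiniteProjective φ ((C.truncGE (a - 1)).X i)
    rcases lt_trichotomy i (a - 1) with hi | rfl | hi
    · have := (C.truncGE (a - 1)).isZero_of_isStrictlyGE (a - 1) i hi
      exact (hC i).of_retract 0 0
        (((ModuleCat.restrictScalars.{u} φ).map_isZero this).eq_of_src _ _)
    · exact (resFiniteProjective_opcycles e (a - 1) (hz _ (by lia)) (hC _)).of_iso
        (C.truncGEXIsoOpcycles _)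
    · exact (hC i).of_iso (C.truncGEXIso _ _ hi)

theorem hasFiniteCohomology_of_finite_homology {Y : CochainComplex (ModuleCat.{u} B) ℤ}
    (h : ∀ i, Finite (Y.homology i)) : GroupModule.HasFiniteCohomology Y := by
  intro i
  have := h i
  let S := Y.sc' (i - 1) i (i + 1)
  let e : Y.homology i ≅ S.moduleCatLeftHomologyData.H :=
    ShortComplex.homologyMapIso (Y.isoSc' (i - 1) i (i + 1) (by simp) (by simp)) ≪≫
      S.moduleCatHomologyIso
  have hfin : Finite (LinearMap.ker S.g.hom ⧸ LinearMap.range S.moduleCatToCycles) :=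
    Finite.of_equiv _ e.toLinearEquiv.toEquiv
  have hle : LinearMap.range S.moduleCatToCycles ≤
      ((coboundaries Y i).submoduleOf (cocycles Y i)).comap LinearMap.id := by
    rintro _ ⟨x, rfl⟩
    exact ⟨x, rfl⟩
  refine Finite.of_surjective (Submodule.mapQ _ _ LinearMap.id hle) fun y => ?_
  obtain ⟨z, rfl⟩ := Submodule.Quotient.mk_surjective _ y
  exact ⟨Submodule.Quotient.mk z, rfl⟩

theorem finite_homology_of_resComplex [Finite A] {Y : CochainComplex (ModuleCat.{u} B) ℤ}
    {K : CochainComplex (ModuleCat.{u} A) ℤ} (hK : IsBoundedProj K) (i : ℤ)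
    (e : ((resComplex φ).obj Y).homology i ≅ K.homology i) : Finite (Y.homology i) := by
  have := (hK.2 i).1
  have hKi : Finite (K.X i) := Module.finite_of_finite A
  have hc : Finite (K.cycles i) := Finite.of_injective (K.iCycles i).hom
    ((ModuleCat.mono_iff_injective _).1 inferInstance)
  have hh : Finite (K.homology i) := Finite.of_surjective (K.homologyπ i).hom
    ((ModuleCat.epi_iff_surjective _).1 inferInstance)
  have e' : (ModuleCat.restrictScalars.{u} φ).obj (Y.homology i) ≅ K.homology i :=
    ((Y.sc i).mapHomologyIso (ModuleCat.restrictScalars.{u} φ)).symm ≪≫ e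
  exact Finite.of_equiv (K.homology i) e'.toLinearEquiv.symm.toEquiv

end

end RelHo

/-! ### Perfect restriction for group algebras -/

namespace GroupModule
open RelHo ModuleComplex GoodGroup DerivedCategory

variable (k : Type u) [Field k] {Υ : Type u} [Group Υ] (H : Subgroup Υ)

instance :
    (ModuleCat.restrictScalars.{u} (groupAlgebraInclusion k H)).PreservesProjectiveObjects where
  projective_obj {P} hP := by
    let F := ModuleCat.restrictScalars.{u} (groupAlgebraInclusion k H)
    have hP : Module.Projective (MonoidAlgebra k Υ) P := (IsProjective.iff_projective P).2 hP
    obtain ⟨s, hs⟩ := Module.projective_def'.1 hP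
    have hR : Module.Projective (MonoidAlgebra k H) (F.obj (ModuleCat.of _ (MonoidAlgebra k Υ))) :=
      projective_of_injective H.subtype H.subtype_injective (AddEquiv.refl (MonoidAlgebra k Υ))
        fun r x => rfl
    classical
    have : Module.Projective (MonoidAlgebra k H)
        (P →₀ F.obj (ModuleCat.of _ (MonoidAlgebra k Υ))) :=
      Module.Projective.of_equiv (finsuppLequivDFinsupp (MonoidAlgebra k H)).symm
    let e : (P →₀ F.obj (ModuleCat.of _ (MonoidAlgebra k Υ))) ≃ₗ[MonoidAlgebra k H]
        F.obj (ModuleCat.of _ (P →₀ MonoidAlgebra k Υ)) :=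
      { AddEquiv.refl (P →₀ MonoidAlgebra k Υ) with map_smul' := fun r x => rfl }
    have := Module.Projective.of_equiv e
    refine (IsProjective.iff_projective (F.obj P)).1 (Module.Projective.of_split
      (F.map (ModuleCat.ofHom s)).hom
      (F.map (ModuleCat.ofHom (Finsupp.linearCombination (MonoidAlgebra k Υ) id))).hom ?_)
    exact LinearMap.ext fun x => congrArg (fun ψ => ψ x) hs

variable {k} [HasDerivedCategory.{w₁} (ModuleCat.{u} (MonoidAlgebra k Υ))]
  [HasDerivedCategory.{w₂} (ModuleCat.{u} (MonoidAlgebra k H))]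

/-- An object of `D(kΥ)` with perfect restriction is represented by a complex whose restriction is a
bounded complex of finitely generated projectives: resolve a bounded below injective representative
by finite modules that are projective over `kH`, and truncate. -/
theorem exists_resBoundedProj_iso [Finite k] [H.Normal] [Finite H] (hG : IsGood (Υ ⧸ H))
    (D : DerivedCategory (ModuleCat.{u} (MonoidAlgebra k Υ)))
    (hD : resPerfect.{u, w₁, w₂} (groupAlgebraInclusion k H) D) :
    ∃ C : CochainComplex (ModuleCat.{u} (MonoidAlgebra k Υ)) ℤ,
      IsBoundedProj ((resComplex (groupAlgebraInclusion k H)).obj C) ∧ Nonempty (Q.obj C ≅ D) := by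
  obtain ⟨K, hK, ⟨e⟩⟩ := hD
  have : Finite (MonoidAlgebra k H) := finite_monoidAlgebra H
  obtain ⟨⟨a, b, hab⟩, -⟩ := id hK
  let φ := groupAlgebraInclusion k H
  have hKz (i : ℤ) (hi : i < a ∨ b < i) : IsZero (K.homology i) :=
    ShortComplex.isZero_homology_of_isZero_X₂ (K.sc i) (hab i hi)
  have hex {Y : CochainComplex (ModuleCat.{u} (MonoidAlgebra k Υ)) ℤ} (eY : D ≅ Q.obj Y) (i : ℤ)
      (hi : i < a ∨ b < i) : Y.ExactAt i := by
    rw [← exactAt_resComplex_iff φ, HomologicalComplex.exactAt_iff_isZero_homology]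
    exact (hKz i hi).of_iso (nonempty_homology_iso ((mapDerivedCategoryIso φ eY).symm ≪≫ e) i).some
  let X := Q.objPreimage D
  have eX : D ≅ Q.obj X := (Q.objObjPreimageIso D).symm
  have : X.IsGE a := (CochainComplex.isGE_iff X a).2 fun i hi => hex eX i (.inl hi)
  obtain ⟨I, j, hj, hI, hIa⟩ :=
    CochainComplex.Plus.modelCategoryQuillen.exists_quasiIso_injective (X.truncGE a) a
  have eI : D ≅ Q.obj I := eX ≪≫ asIso (Q.map (X.πTruncGE a)) ≪≫ asIso (Q.map j)
  have hfin : HasFiniteCohomology I := hasFiniteCohomology_of_finite_homology fun i =>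
    finite_homology_of_resComplex hK i
      (nonempty_homology_iso ((mapDerivedCategoryIso φ eI).symm ≪≫ e) i).some
  obtain ⟨C, f, hf, hC, hCb⟩ := exists_resolution (Q := finiteProjective k H) ⟨inferInstance, by
    have : Subsingleton ((ModuleCat.restrictScalars φ).obj
      (ModuleCat.of (MonoidAlgebra k Υ) PUnit.{u + 1})) := inferInstanceAs (Subsingleton PUnit)
    infer_instance⟩
    (hasCovers_finiteProjective H hG I a hfin) b fun i hi => hex eI i (.inr hi)
  have eC : D ≅ Q.obj C := eI ≪≫ (asIso (Q.map f)).symm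
  have hC' (i : ℤ) : resFiniteProjective φ (C.X i) := by
    have := (hC i).1
    have : Finite ((ModuleCat.restrictScalars.{u} φ).obj (C.X i)) := (hC i).1
    exact ⟨inferInstance, (hC i).2⟩
  have (i : ℤ) : Projective (((resComplex φ).obj C).X i) :=
    (IsProjective.iff_projective (((resComplex φ).obj C).X i)).1 (hC' i).2
  have : ((resComplex φ).obj C).IsStrictlyLE b := (CochainComplex.isStrictlyLE_iff _ b).2
    fun i hi => (ModuleCat.restrictScalars.{u} φ).map_isZero (C.isZero_of_isStrictlyLE b i hi)
  have : ((resComplex φ).obj C).IsKProjective := CochainComplex.isKProjective_of_projective _ b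
  have := hK.isKProjective
  have e' := nonempty_iso_of_isKProjective ((mapDerivedCategoryIso φ eC).symm ≪≫ e)
  obtain ⟨m, hm, hm'⟩ := exists_isBoundedProj_truncGE b hC' hK
    (HomotopyCategory.homotopyEquivOfIso e'.some)
  exact ⟨C.truncGE m, hm', ⟨(asIso (Q.map (C.πTruncGE m))).symm ≪≫ eC.symm⟩⟩

end GroupModule

theorem mainTheorem9 (k : Type u) [Field k] [Finite k] (Υ : Type u) [Group Υ]
    (H : Subgroup Υ) [H.Normal] [Finite H] (hgood : GoodGroup.IsGood (Υ ⧸ H))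
    [HasDerivedCategory.{w₁} (ModuleCat.{u} (MonoidAlgebra k Υ))]
    [HasDerivedCategory.{w₂} (ModuleCat.{u} (MonoidAlgebra k H))] :
    RelHo.InducesEquivalence (RelHo.hoRelToDerived (groupAlgebraInclusion k H))
        (RelHo.resBoundedProj (groupAlgebraInclusion k H))
        (RelHo.resPerfect (groupAlgebraInclusion k H)) ∧
      RelHo.InducesEquivalence (RelHo.hoRelToDerived (groupAlgebraInclusion k H))
        (RelHo.resHoBoundedProj (groupAlgebraInclusion k H))
        (RelHo.resPerfect (groupAlgebraInclusion k H)) :=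
  ⟨RelHo.inducesEquivalence_resBoundedProj _
    (GroupModule.exists_resBoundedProj_iso H hgood), RelHo.inducesEquivalence_resHoBoundedProj _⟩
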